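/- **Setting.** Let $\Lambda$ be a square domain with free or periodic boundary conditions: for $L>1$, either the $L\times L$ grid graph on $\{0,\dots,L-1\}^2$, or, for $L$ even, the discrete torus on the same vertex set. Write $\operatorname{dist}$ for the graph distance (for sets, the minimal distance between their points), $j\sim\ell$ for adjacency, $(\Delta_\Lambda f)(j)=\sum_{\ell\sim j}(f_\ell-f_j)$, and $\operatorname{supp}f=\{j: f_j\ne0\}$. Fix $3/2<\alpha<2$, $M=2^{16}$. A *density* is a function $\varrho:\Lambda\to\mathbb Z$ that is not identically zero. Put $d(\varrho)=\max_{i,j\in\operatorname{supp}\varrho}\operatorname{dist}(i,j)$, $Q(\varrho)=\sum_j\varrho(j)$, $\|\varrho\|_2^2=\sum_j\varrho(j)^2$ and $\operatorname{dist}(\varrho_1,\varrho_2)=\operatorname{dist}(\operatorname{supp}\varrho_1,\operatorname{supp}\varrho_2)$; $\varrho$ is *neutral* if $Q(\varrho)=0$. For each density fix (arbitrarily) a center $j_\varrho\in\operatorname{supp}\varrho$ such that $d(\varrho)=\operatorname{dist}(j_\varrho,k)$ for some $k\in\operatorname{supp}\varrho$, and let $$D(\varrho)=\{\ell:\operatorname{dist}(\ell,j_\varrho)<2d(\varrho)\},\qquad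 D^+(\varrho)=\{j:\operatorname{dist}(j,D(\varrho))\le1\}.$$ A *$2^k\times2^k$ square* is a set of the form $\{(c,d)\in\Lambda: c-a,\ d-b\in\{0,\dots,2^k-1\}\}$ with $(a,b)\in\Lambda$ (differences taken modulo $L$ in the periodic case), required to have $2^{2k}$ points if $2^k\le L$ and to be equal to $\Lambda$ if $2^k>L$. For each density $\varrho$ and $k\ge0$ fix (arbitrarily) a collection $\mathscr S_k(\varrho)$ of $2^k\times2^k$ squares covering $\operatorname{supp}\varrho$ of minimal cardinality. For $k\ge1$ let $\mathscr S^{\rm sep}_k(\varrho)=\emptyset$ if $|\mathscr S_k(\varrho)|=1$, and otherwise $$\mathscr S^{\rm sep}_k(\varrho)=\{s\in\mathscr S_k(\varrho):\operatorname{dist}(s',s)\ge 2M2^{\alpha(k+1)}\ \text{ for all } s'\in\mathscr S_k(\varrho)\setminus\{s\}\}.$$ For $\beta>0$ and $a:\Lambda\to\mathbb R$ let $E_\beta(a,\varrho)=\sum_j a_j\varrho(j)-\frac\beta2\sum_{j\sim\ell}(a_j-a_\ell)^2$, each edge being counted once. Let $\mathscr N$ be an *ensemble*, that is, a finite (possibly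 empty) collection of densities with mutually disjoint supports, such that: (a) $\mathscr N$ contains at most one non-neutral density; (b) distinct $\varrho_1,\varrho_2\in\mathscr N$ satisfy $\operatorname{dist}(\varrho_1,\varrho_2)\ge M[\min(d(\varrho_1),d(\varrho_2))]^\alpha$, and if $\varrho_c\in\mathscr N$ is non-neutral then $\operatorname{dist}(\varrho,\varrho_c)\ge M[d(\varrho)]^\alpha$ for all $\varrho\in\mathscr N$, $\varrho\ne\varrho_c$; (c) whenever a neutral $\varrho\in\mathscr N$ is written as $\varrho=\varrho_1+\varrho_2$ with densities $\varrho_1,\varrho_2$ of disjoint supports and $\operatorname{dist}(\varrho_1,\varrho_2)\ge 2M[\min(d(\varrho_1),d(\varrho_2))]^\alpha$, both $\varrho_1$ and $\varrho_2$ are non-neutral. Let $\mathscr N_0$ be the set of neutral densities of $\mathscr N$, and for $\varrho\in\mathscr N_0$ let $\mathscr N_0(\varrho)=\{\varrho'\in\mathscr N_0: d(\varrho')\le 2d(\varrho),\ \varrho'\ne\varrho\}$. **Proposition (Spin Wave Existence).** There is a constant $D_3>0$, depending only on the fixed $\alpha$ (in particular not on $\Lambda$, $\beta$, $\mathscr N$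 or the choices of centers and coverings), such that for each $\varrho\in\mathscr N_0$ there exists $a_\varrho:\Lambda\to\mathbb R$ with the following properties: 1. for every $\varrho'\in\mathscr N_0(\varrho)$, $a_\varrho$ is constant on $D^+(\varrho')$; 2. $\operatorname{supp}a_\varrho\subseteq D(\varrho)$, and $\operatorname{supp}a_\varrho$ is disjoint from $\operatorname{supp}\varrho'$ for every $\varrho'\in\mathscr N_0\setminus\mathscr N_0(\varrho)$ with $\varrho'\ne\varrho$; 3. $\operatorname{supp}(\Delta_\Lambda a_\varrho)\subseteq D(\varrho)$; 4. the sum $\sum_{k\ge1}|\mathscr S^{\rm sep}_k(\varrho)|$ is finite and $$E_\beta(a_\varrho,\varrho)\ \ge\ \frac1\beta\Big(\frac1{16}\|\varrho\|_2^2+D_3\sum_{k=1}^\infty|\mathscr S^{\rm sep}_k(\varrho)|\Big).$$ -/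

import Mathlib

namespace SpinWave

/-! ### Square domains -/

/-- The two kinds of boundary conditions under consideration. -/
inductive BoundaryCondition
  | free
  | periodic

/-- The square domain of side `L`, with vertex set `{0, …, L-1}²`.  With free boundary conditions
it is the `L × L` grid (the product of two paths), with periodic boundary conditions it is the
discrete torus (the product of two cycles). -/
def squareDomain (bc : BoundaryCondition) (L : ℕ) : SimpleGraph (Fin L × Fin L) :=
  match bc with
  | .free => SimpleGraph.boxProd (SimpleGraph.pathGraph L) (SimpleGraph.pathGraph L)
  | .periodic => SimpleGraph.boxProd (SimpleGraph.cycleGraph L) (SimpleGraph.cycleGraph L)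

/-- The set of vertices `(c, d)` such that `c - a` and `d - b` (reduced modulo `L` for periodic
boundary conditions) belong to `{0, …, w - 1}`, where `p = (a, b)`. -/
def box (bc : BoundaryCondition) (L w : ℕ) (p : Fin L × Fin L) : Finset (Fin L × Fin L) :=
  match bc with
  | .free => {q | (p.1.val ≤ q.1.val ∧ q.1.val < p.1.val + w) ∧
      (p.2.val ≤ q.2.val ∧ q.2.val < p.2.val + w)}
  | .periodic => {q | ((q.1.val : ℤ) - (p.1.val : ℤ)) % (L : ℤ) < (w : ℤ) ∧
      ((q.2.val : ℤ) - (p.2.val : ℤ)) % (L : ℤ) < (w : ℤ)}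

/-- `s` is a `2^k × 2^k` square of the square domain.  It has `2^k · 2^k` points, unless `2^k > L`,
in which case it is the whole domain. -/
def IsSquare (bc : BoundaryCondition) (L k : ℕ) (s : Finset (Fin L × Fin L)) : Prop :=
  (∃ p, s = box bc L (2 ^ k) p) ∧
    if 2 ^ k ≤ L then s.card = 2 ^ k * 2 ^ k else s = Finset.univ

section Graph

variable {V : Type*} [Fintype V] [DecidableEq V]

/-- Graph distance between two sets of vertices; only used for non-empty sets, where it is the
minimum of the distances between their points. -/
noncomputable def setDist (G : SimpleGraph V) (A B : Finset V) : ℕ :=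
  sInf {n | ∃ i ∈ A, ∃ j ∈ B, G.dist i j = n}

open Classical in
/-- The finite difference Laplacian `(Δ f)(j) = ∑_{l ∼ j} (f l - f j)`. -/
noncomputable def laplacian (G : SimpleGraph V) (f : V → ℝ) (j : V) : ℝ :=
  ∑ l, if G.Adj j l then f l - f j else 0

open Classical in
/-- `∑_{j ∼ l} (a j - a l)²`, each edge counted once (the double sum over ordered pairs counts
every edge twice). -/
noncomputable def dirichlet (G : SimpleGraph V) (a : V → ℝ) : ℝ :=
  (∑ j, ∑ l, if G.Adj j l then (a j - a l) ^ 2 else 0) / 2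

/-! ### Densities.  A charge density is a function `ρ : V → ℤ` with `ρ ≠ 0`. -/

/-- The support of an integer valued function. -/
def supp (ρ : V → ℤ) : Finset V := {j | ρ j ≠ 0}

/-- The diameter of the support. -/
noncomputable def diam (G : SimpleGraph V) (ρ : V → ℤ) : ℕ :=
  (supp ρ ×ˢ supp ρ).sup fun p => G.dist p.1 p.2

/-- The total charge. -/
def charge (ρ : V → ℤ) : ℤ := ∑ j, ρ j

/-- The Euclidean norm of a density. -/
noncomputable def norm₂ (ρ : V → ℤ) : ℝ := Real.sqrt (∑ j, (ρ j : ℝ) ^ 2)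

/-- The distance between (the supports of) two densities. -/
noncomputable def chargeDist (G : SimpleGraph V) (ρ₁ ρ₂ : V → ℤ) : ℕ :=
  setDist G (supp ρ₁) (supp ρ₂)

/-- `E_β(a, ρ) = ⟨a, ρ⟩ - (β/2) ∑_{j ∼ l} (a j - a l)²`. -/
noncomputable def energy (G : SimpleGraph V) (β : ℝ) (a : V → ℝ) (ρ : V → ℤ) : ℝ :=
  (∑ j, a j * (ρ j : ℝ)) - β / 2 * dirichlet G a

/-- `center` selects, for every density `ρ`, a point of its support that realizes the diameter
together with some other point of the support. -/
def IsCenterChoice (G : SimpleGraph V) (center : (V → ℤ) → V) : Prop :=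
  ∀ ρ : V → ℤ, ρ ≠ 0 →
    center ρ ∈ supp ρ ∧ ∃ k ∈ supp ρ, diam G ρ = G.dist (center ρ) k

/-- `D(ρ)`: the points at distance less than `2 d(ρ)` from the chosen center. -/
def D (G : SimpleGraph V) (center : (V → ℤ) → V) (ρ : V → ℤ) : Set V :=
  {l | G.dist l (center ρ) < 2 * diam G ρ}

/-- `D⁺(ρ)`: the points at distance at most `1` from `D(ρ)`. -/
def DPlus (G : SimpleGraph V) (center : (V → ℤ) → V) (ρ : V → ℤ) : Set V :=
  {j | ∃ i ∈ D G center ρ, G.dist j i ≤ 1}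

/-- The constant `M`. -/
def M : ℝ := 2 ^ 16

/-! ### Ensembles -/

/-- A finite collection of densities with mutually disjoint supports. -/
def IsEnsemble (N : Finset (V → ℤ)) : Prop :=
  (∀ ρ ∈ N, ρ ≠ 0) ∧ ∀ ρ₁ ∈ N, ∀ ρ₂ ∈ N, ρ₁ ≠ ρ₂ → Disjoint (supp ρ₁) (supp ρ₂)

/-- The three separation properties of an ensemble. -/
structure IsSeparated (G : SimpleGraph V) (α : ℝ) (N : Finset (V → ℤ)) : Prop where
  /-- There is at most one non-neutral density. -/
  charged_unique : ∀ ρ₁ ∈ N, ∀ ρ₂ ∈ N, charge ρ₁ ≠ 0 → charge ρ₂ ≠ 0 → ρ₁ = ρ₂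
  /-- Distinct densities are far from each other. -/
  far : ∀ ρ₁ ∈ N, ∀ ρ₂ ∈ N, ρ₁ ≠ ρ₂ →
    M * ((min (diam G ρ₁) (diam G ρ₂) : ℕ) : ℝ) ^ α ≤ (chargeDist G ρ₁ ρ₂ : ℝ)
  /-- All other densities are far from a non-neutral one, relative to their own diameter. -/
  far_charged : ∀ ρc ∈ N, charge ρc ≠ 0 → ∀ ρ ∈ N, ρ ≠ ρc →
    M * (diam G ρ : ℝ) ^ α ≤ (chargeDist G ρ ρc : ℝ)
  /-- A neutral density does not split into two far away neutral densities. -/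
  decomposition : ∀ ρ ∈ N, charge ρ = 0 → ∀ ρ₁ ρ₂ : V → ℤ, ρ₁ ≠ 0 → ρ₂ ≠ 0 →
    Disjoint (supp ρ₁) (supp ρ₂) → ρ = ρ₁ + ρ₂ →
    2 * M * ((min (diam G ρ₁) (diam G ρ₂) : ℕ) : ℝ) ^ α ≤ (chargeDist G ρ₁ ρ₂ : ℝ) →
    charge ρ₁ ≠ 0 ∧ charge ρ₂ ≠ 0

/-- The neutral densities of an ensemble. -/
def neutral (N : Finset (V → ℤ)) : Finset (V → ℤ) := {ρ ∈ N | charge ρ = 0}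

/-- The densities, other than `ρ`, of smaller diameter than `ρ` or of comparable diameter. -/
noncomputable def smaller (G : SimpleGraph V) (N₀ : Finset (V → ℤ)) (ρ : V → ℤ) :
    Finset (V → ℤ) :=
  {ρ' ∈ N₀ | diam G ρ' ≤ 2 * diam G ρ ∧ ρ ≠ ρ'}

open Classical in
/-- The squares of a scale `k` collection `S` that are separated from all other squares of `S`;
by convention there are none when `S` consists of a single square. -/
noncomputable def separatedSquares (G : SimpleGraph V) (α : ℝ) (k : ℕ) (S : Finset (Finset V)) :
    Finset (Finset V) :=
  if S.card = 1 then ∅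
  else {s ∈ S | ∀ s' ∈ S, s' ≠ s →
    2 * M * (2 : ℝ) ^ (α * ((k : ℝ) + 1)) ≤ (setDist G s' s : ℝ)}

end Graph

/-! ### Square coverings -/

/-- `S` is a collection of `2^k × 2^k` squares that covers the support of `ρ`. -/
def IsSquareCover (bc : BoundaryCondition) (L k : ℕ) (ρ : Fin L × Fin L → ℤ)
    (S : Finset (Finset (Fin L × Fin L))) : Prop :=
  (∀ s ∈ S, IsSquare bc L k s) ∧ ∀ j ∈ supp ρ, ∃ s ∈ S, j ∈ s

/-- `S` selects, for every density `ρ` and every scale `k`, a covering of the support of `ρ` by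
`2^k × 2^k` squares that has the least possible number of squares. -/
def IsMinimalCoverChoice (bc : BoundaryCondition) (L : ℕ)
    (S : ℕ → (Fin L × Fin L → ℤ) → Finset (Finset (Fin L × Fin L))) : Prop :=
  ∀ k, ∀ ρ : Fin L × Fin L → ℤ, ρ ≠ 0 →
    IsSquareCover bc L k ρ (S k ρ) ∧
      ∀ T, IsSquareCover bc L k ρ T → (S k ρ).card ≤ T.card

end SpinWave

/-! The wave is a sum of elementary pieces, no two of which vary along the same edge, so that their
energies add.

The first piece gives the norm term. The domain is bipartite, so one colour class carries at least
half of `‖ρ‖₂²`. A multiple of `ρ` restricted to that class has Dirichlet energy controlled by the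
degree bound 4 (`energy_colorPart_ge`).

Each separated square gives one further piece. It cuts out an island `B` of `supp ρ`, far from the
rest of the support, and the decomposition property forces its charge to be nonzero
(`IsSeparated.isIsland`). A cut-off equal to 1 on `B` and vanishing on the rest of `supp ρ` has
Dirichlet energy bounded independently of the scale, as usual in dimension two. With a suitable
coefficient it therefore gains a fixed multiple of `1/β`.

The cut-offs must be constant on every obstacle `D⁺(ρ')`. They are made functions of the distance to
`B` in the graph where each obstacle is collapsed to a point: `Chain` describes paths there and
`level` is the resulting distance. The main estimate, `dist_le_four_mul`, says that collapsing
shortens distances from `supp ρ` by at most a factor 4. It rests on an induction over dyadic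
obstacle sizes, `dist_le_of_chain`, in which the condition `α > 3/2` makes gaps between obstacles
large enough to absorb the errors. `exists_wave` assembles the pieces. -/

namespace SpinWave

/-! ### Distances after collapsing a sparse family of obstacles. -/

section Chains

variable {V : Type*}

/-- `Chain G R x p n`: the vertex `p` can be reached from `x` by `n` steps along edges of `G` and
any number of free jumps along `R`. -/
inductive Chain (G : SimpleGraph V) (R : V → V → Prop) (x : V) : V → ℕ → Prop
  | refl : Chain G R x x 0
  | step {p q : V} {n : ℕ} : Chain G R x p n → G.Adj p q → Chain G R x q (n + 1)
  | jump {p q : V} {n : ℕ} : Chain G R x p n → R p q → Chain G R x q n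

lemma Chain.of_walk {G : SimpleGraph V} (R : V → V → Prop) {x p q : V} {n : ℕ}
    (h : Chain G R x p n) (w : G.Walk p q) : Chain G R x q (n + w.length) := by
  induction w generalizing n with
  | nil => simpa using h
  | cons e w ih =>
    have := ih (h.step e)
    rw [SimpleGraph.Walk.length_cons]
    convert this using 1
    omega

/-- Jumps inside the sets `A i` of size less than `2 ^ m`. -/
def JumpBelow {ι : Type*} (A : ι → Set V) (d : ι → ℕ) (m : ℕ) (p q : V) : Prop :=
  ∃ i, d i < 2 ^ m ∧ p ∈ A i ∧ q ∈ A i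

/-- The sets `A i`, of size `d i` around `c i`, are separated on every dyadic scale. -/
structure IsSparse {ι : Type*} (G : SimpleGraph V) (A : ι → Set V) (c : ι → V) (d : ι → ℕ) :
    Prop where
  dist_center : ∀ i, ∀ z ∈ A i, G.dist z (c i) ≤ 2 * d i
  center_mem : ∀ i, c i ∈ A i
  pos : ∀ i, 1 ≤ d i
  separated : ∀ i j, i ≠ j → ∀ m, 2 ^ m ≤ d i → 2 ^ m ≤ d j →
    65536 * (14 / 5 : ℝ) ^ m ≤ G.dist (c i) (c j)

variable {ι : Type*} {G : SimpleGraph V} {A : ι → Set V} {c : ι → V} {d : ι → ℕ}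

lemma dist_triangle_real (hG : G.Connected) (x y z : V) :
    (G.dist x z : ℝ) ≤ G.dist x y + G.dist y z := by
  exact_mod_cast hG.dist_triangle

lemma IsSparse.dist_center_real (h : IsSparse G A c d) {i : ι} {m : ℕ} (hi : d i < 2 ^ (m + 1))
    {z : V} (hz : z ∈ A i) : (G.dist z (c i) : ℝ) ≤ 4 * 2 ^ m := by
  have h1 := h.dist_center i z hz
  have h2 : G.dist z (c i) ≤ 4 * 2 ^ m := by rw [pow_succ] at hi; omega
  exact_mod_cast h2

lemma IsSparse.dist_real (h : IsSparse G A c d) (hG : G.Connected) {i : ι} {m : ℕ}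
    (hi : d i < 2 ^ (m + 1)) {y z : V} (hy : y ∈ A i) (hz : z ∈ A i) :
    (G.dist y z : ℝ) ≤ 8 * 2 ^ m := by
  have h1 := h.dist_center_real hi hy
  have h2 := h.dist_center_real hi hz
  have h3 := dist_triangle_real hG y (c i) z
  rw [SimpleGraph.dist_comm (u := z)] at h2
  linarith

lemma pow_scales (m : ℕ) :
    (2 : ℝ) ^ m ≤ (9 / 4) ^ m ∧ (9 / 4 : ℝ) ^ m ≤ (63 / 25) ^ m ∧
      (63 / 25 : ℝ) ^ m ≤ (14 / 5) ^ m ∧ (9 / 10 : ℝ) ^ m * (14 / 5) ^ m = (63 / 25) ^ m ∧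
      (0 : ℝ) < 2 ^ m := by
  refine ⟨?_, ?_, ?_, ?_, by positivity⟩
  · exact pow_le_pow_left₀ (by norm_num) (by norm_num) m
  · exact pow_le_pow_left₀ (by norm_num) (by norm_num) m
  · exact pow_le_pow_left₀ (by norm_num) (by norm_num) m
  · rw [← mul_pow]; norm_num

/-- Decomposition of a chain at its last jump of the highest dyadic size. -/
lemma chain_split (hG : G.Connected) (h : IsSparse G A c d) (m : ℕ)
    (ih : ∀ x p n, Chain G (JumpBelow A d m) x p n →
      (G.dist x p : ℝ) ≤ (2 - (9 / 10) ^ m) * n + 32 * (9 / 4) ^ m)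
    {x p : V} {n : ℕ} (hc : Chain G (JumpBelow A d (m + 1)) x p n) :
    Chain G (JumpBelow A d m) x p n ∨
      ∃ i n₀ n₁, 2 ^ m ≤ d i ∧ d i < 2 ^ (m + 1) ∧ n₀ + n₁ = n ∧
        (∃ y ∈ A i, Chain G (JumpBelow A d m) y p n₁) ∧
        ∀ z ∈ A i, (G.dist x z : ℝ) ≤
          (2 - (9 / 10) ^ (m + 1)) * n₀ + (32 * (9 / 4) ^ m + 8 * 2 ^ m) := by
  have hpow : (9 / 10 : ℝ) ^ (m + 1) = 9 / 10 * (9 / 10) ^ m := by rw [pow_succ]; ring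
  have hpos : (0 : ℝ) < (9 / 10) ^ m := by positivity
  obtain ⟨s1, s2, s3, s4, s5⟩ := pow_scales m
  induction hc with
  | refl => exact Or.inl .refl
  | step _ e hyp =>
    rcases hyp with hyp | ⟨i, n₀, n₁, h1, h2, h3, ⟨y, hy, hyc⟩, h4⟩
    · exact Or.inl (hyp.step e)
    · exact Or.inr ⟨i, n₀, n₁ + 1, h1, h2, by omega, ⟨y, hy, hyc.step e⟩, h4⟩
  | @jump p q n _ e hyp =>
    obtain ⟨b, hb, hp, hq⟩ := e
    by_cases hbm : d b < 2 ^ m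
    · have e' : JumpBelow A d m p q := ⟨b, hbm, hp, hq⟩
      rcases hyp with hyp | ⟨i, n₀, n₁, h1, h2, h3, ⟨y, hy, hyc⟩, h4⟩
      · exact Or.inl (hyp.jump e')
      · exact Or.inr ⟨i, n₀, n₁, h1, h2, h3, ⟨y, hy, hyc.jump e'⟩, h4⟩
    · push Not at hbm
      right
      rcases hyp with hyp | ⟨i, n₀, n₁, h1, h2, h3, ⟨y, hy, hyc⟩, h4⟩
      · refine ⟨b, n, 0, hbm, hb, rfl, ⟨q, hq, .refl⟩, fun z hz => ?_⟩
        have t1 := ih _ _ _ hyp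
        have t2 := h.dist_real hG hb hp hz
        have t3 := dist_triangle_real hG x p z
        have : (0 : ℝ) ≤ (9 / 10) ^ m * n := by positivity
        rw [hpow]
        nlinarith
      · by_cases hib : i = b
        · subst hib
          refine ⟨i, n, 0, h1, h2, rfl, ⟨q, hq, .refl⟩, fun z hz => ?_⟩
          have t1 := h4 z hz
          have t2 : (n₀ : ℝ) ≤ n := by exact_mod_cast (by omega : n₀ ≤ n)
          have t3 : (9 / 10 : ℝ) ^ (m + 1) ≤ 1 := pow_le_one₀ (by norm_num) (by norm_num)
          have t4 : (2 - (9 / 10 : ℝ) ^ (m + 1)) * n₀ ≤ (2 - (9 / 10) ^ (m + 1)) * n :=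
            mul_le_mul_of_nonneg_left t2 (by linarith)
          linarith
        · refine ⟨b, n, 0, hbm, hb, rfl, ⟨q, hq, .refl⟩, fun z hz => ?_⟩
          have t0 := ih _ _ _ hyc
          have t1 := h.separated i b hib m h1 hbm
          have t2 := h.dist_center_real h2 hy
          rw [SimpleGraph.dist_comm] at t2
          have t3 := h.dist_center_real hb hp
          have t4 := dist_triangle_real hG (c i) y (c b)
          have t5 := dist_triangle_real hG y p (c b)
          have t6 := h4 y hy
          have t7 := h.dist_real hG hb hp hz
          have t8 := dist_triangle_real hG x y z
          have t9 := dist_triangle_real hG y p z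
          have hn : (n : ℝ) = n₀ + n₁ := by exact_mod_cast h3.symm
          have t10 : (0 : ℝ) ≤ (9 / 10) ^ m * n₁ := by positivity
          -- Between two different obstacles of top size the chain must cross the gap, so `n₁` is
          -- large. Raising the slope by `(9/10)^m / 10` then gains at least `3200 * (63/25)^m` on
          -- these steps, more than the new error `32 * (9/4)^m + 8 * 2^m`. Thus additive errors do
          -- not accumulate over successive top-size jumps.
          have t11 : 32000 * (14 / 5 : ℝ) ^ m ≤ n₁ := by nlinarith
          have t12 : (9 / 10 : ℝ) ^ m * (32000 * (14 / 5 : ℝ) ^ m) ≤ (9 / 10) ^ m * n₁ := by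
            gcongr
          have t13 : (9 / 10 : ℝ) ^ m * (32000 * (14 / 5 : ℝ) ^ m) = 32000 * (63 / 25) ^ m := by
            rw [← s4]; ring
          rw [hpow] at t6 ⊢
          rw [hn]
          nlinarith

/-- Induction on the dyadic size of the permitted jumps. Each scale costs a little slope, which
stays below 2, and a larger additive constant. The growth rate `9/4` lies below `(9/10) * (14/5) =
63/25`, so that the slope gained across a gap dominates the constant. -/
lemma dist_le_of_chain (hG : G.Connected) (h : IsSparse G A c d) (m : ℕ) :
    ∀ x p n, Chain G (JumpBelow A d m) x p n →
      (G.dist x p : ℝ) ≤ (2 - (9 / 10) ^ m) * n + 32 * (9 / 4) ^ m := by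
  induction m with
  | zero =>
    intro x p n hc
    have : (G.dist x p : ℝ) ≤ n := by
      induction hc with
      | refl => simp
      | @step p q n _ e ih =>
        have := dist_triangle_real hG x p q
        rw [SimpleGraph.dist_eq_one_iff_adj.mpr e] at this
        push_cast at this ⊢
        linarith
      | jump _ e ih =>
        obtain ⟨i, hi, _⟩ := e
        have := h.pos i
        simp at hi; omega
    simp only [pow_zero]
    linarith
  | succ m ih =>
    intro x p n hc
    obtain ⟨s1, s2, s3, s4, s5⟩ := pow_scales m
    have hpow : (9 / 10 : ℝ) ^ (m + 1) = 9 / 10 * (9 / 10) ^ m := by rw [pow_succ]; ring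
    have hpow' : (9 / 4 : ℝ) ^ (m + 1) = 9 / 4 * (9 / 4) ^ m := by rw [pow_succ]; ring
    have hpos : (0 : ℝ) < (9 / 10) ^ m := by positivity
    rcases chain_split hG h m ih hc with hc | ⟨i, n₀, n₁, h1, h2, h3, ⟨y, hy, hyc⟩, h4⟩
    · have t1 := ih _ _ _ hc
      have : (0 : ℝ) ≤ (9 / 10) ^ m * n := by positivity
      rw [hpow, hpow']
      nlinarith
    · have t1 := ih _ _ _ hyc
      have t2 := h4 y hy
      have t3 := dist_triangle_real hG x y p
      have hn : (n : ℝ) = n₀ + n₁ := by exact_mod_cast h3.symm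
      have t4 : (0 : ℝ) ≤ (9 / 10) ^ m * n₁ := by positivity
      rw [hpow] at t2 ⊢
      -- The constants close up exactly: `32 + 8 + 32 = 72 = 32 * (9/4)`, using `2^m ≤ (9/4)^m`.
      rw [hpow', hn]
      nlinarith

/-- Collapsing a sparse family of sets that stay away from `x` does not shorten distances from
`x` by more than a factor `4`. -/
lemma dist_le_four_mul (hG : G.Connected) (h : IsSparse G A c d) {x : V}
    (hx : ∀ i m, 2 ^ m ≤ d i → 16384 * (14 / 5 : ℝ) ^ m ≤ G.dist x (c i)) (m : ℕ) :
    ∀ p n, Chain G (JumpBelow A d m) x p n → G.dist x p ≤ 4 * n := by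
  induction m with
  | zero =>
    intro p n hc
    induction hc with
    | refl => simp
    | @step p q n _ e ih =>
      have := hG.dist_triangle (u := x) (v := p) (w := q)
      rw [SimpleGraph.dist_eq_one_iff_adj.mpr e] at this
      omega
    | jump _ e ih =>
      obtain ⟨i, hi, _⟩ := e
      have := h.pos i
      simp at hi; omega
  | succ m ih =>
    intro p n hc
    obtain ⟨s1, s2, s3, s4, s5⟩ := pow_scales m
    have hpos : (0 : ℝ) < (9 / 10) ^ m := by positivity
    have hpos' : (0 : ℝ) < (9 / 10) ^ (m + 1) := by positivity
    rcases chain_split hG h m (dist_le_of_chain hG h m) hc with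
      hc | ⟨i, n₀, n₁, h1, h2, h3, ⟨y, hy, hyc⟩, h4⟩
    · exact ih _ _ hc
    · have t1 := dist_le_of_chain hG h m _ _ _ hyc
      have t2 := h4 y hy
      have t3 := dist_triangle_real hG x y p
      have t4 := h4 _ (h.center_mem i)
      have t5 := hx i m h1
      have hn : (n : ℝ) = n₀ + n₁ := by exact_mod_cast h3.symm
      have t6 : (0 : ℝ) ≤ (9 / 10) ^ m * n₁ := by positivity
      have t7 : (0 : ℝ) ≤ (9 / 10) ^ (m + 1) * n₀ := by positivity
      -- Since `x` is far from `c i`, already `n₀` is of order `(14/5)^m`. The total additive error,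
      -- at most `72 * (9/4)^m`, is then absorbed by doubling the slope from 2 to 4.
      have : (G.dist x p : ℝ) ≤ 4 * n := by
        rw [hn]
        nlinarith
      exact_mod_cast this

end Chains

/-! ### Geometry of the square domains -/

section Line

/-- The one-dimensional factor of the square domain. -/
def line (bc : BoundaryCondition) (L : ℕ) : SimpleGraph (Fin L) :=
  match bc with
  | .free => SimpleGraph.pathGraph L
  | .periodic => SimpleGraph.cycleGraph L

lemma squareDomain_eq (bc : BoundaryCondition) (L : ℕ) :
    squareDomain bc L = SimpleGraph.boxProd (line bc L) (line bc L) := by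
  cases bc <;> rfl

lemma line_le_cycleGraph (bc : BoundaryCondition) (L : ℕ) :
    line bc L ≤ SimpleGraph.cycleGraph L := by
  cases bc
  · exact SimpleGraph.pathGraph_le_cycleGraph
  · exact le_rfl

lemma line_connected (bc : BoundaryCondition) (n : ℕ) : (line bc (n + 1)).Connected := by
  cases bc
  · exact SimpleGraph.pathGraph_connected n
  · exact SimpleGraph.cycleGraph_connected

/-- For the path this allows a spurious wrap-around neighbour, harmless because only upper bounds on
degrees and balls are drawn from it. -/
lemma line_adj {bc : BoundaryCondition} {n : ℕ} {u v : Fin (n + 2)}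
    (h : (line bc (n + 2)).Adj u v) : v = u + 1 ∨ v = u - 1 := by
  have h := SimpleGraph.cycleGraph_adj.mp (line_le_cycleGraph bc _ h)
  rcases h with h | h
  · right; rw [← h]; abel
  · left; rw [← h]; abel

lemma line_exists_coloring (bc : BoundaryCondition) (L : ℕ) (h : bc = .periodic → Even L) :
    ∃ f : Fin L → Bool, ∀ u v, (line bc L).Adj u v → f u ≠ f v := by
  cases bc
  · exact ⟨SimpleGraph.pathGraph.bicoloring L, fun u v e =>
      (SimpleGraph.pathGraph.bicoloring L).valid e⟩
  · exact ⟨SimpleGraph.cycleGraph.bicoloring_of_even L (h rfl), fun u v e =>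
      (SimpleGraph.cycleGraph.bicoloring_of_even L (h rfl)).valid e⟩

lemma dist_pathGraph_le (L m : ℕ) : ∀ i j : Fin L, i.val + m = j.val →
    (SimpleGraph.pathGraph L).dist i j ≤ m := by
  induction m with
  | zero =>
    intro i j h
    have : i = j := Fin.ext (by omega)
    simp [this]
  | succ m ih =>
    intro i j h
    have hj := j.isLt
    obtain ⟨n, rfl⟩ : ∃ n, L = n + 1 := ⟨L - 1, by omega⟩
    have e : (SimpleGraph.pathGraph (n + 1)).Adj ⟨i.val + m, by omega⟩ j :=
      SimpleGraph.pathGraph_adj.mpr (Or.inl (by simp; omega))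
    have h1 := ih i ⟨i.val + m, by omega⟩ rfl
    have h2 := (SimpleGraph.pathGraph_connected n).dist_triangle (u := i)
      (v := ⟨i.val + m, by omega⟩) (w := j)
    rw [SimpleGraph.dist_eq_one_iff_adj.mpr e] at h2
    omega

lemma dist_cycleGraph_le (L m : ℕ) : ∀ i j : Fin L, (i.val + m) % L = j.val →
    (SimpleGraph.cycleGraph L).dist i j ≤ m := by
  induction m with
  | zero =>
    intro i j h
    have : i = j := Fin.ext (by rw [← h, Nat.add_zero, Nat.mod_eq_of_lt i.isLt])
    simp [this]
  | succ m ih =>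
    intro i j h
    have hi := i.isLt
    obtain ⟨n, rfl⟩ : ∃ n, L = n + 1 := ⟨L - 1, by omega⟩
    have hlt : (i.val + m) % (n + 1) < n + 1 := Nat.mod_lt _ (by omega)
    set k : Fin (n + 1) := ⟨(i.val + m) % (n + 1), hlt⟩ with hk
    have h1 := ih i k rfl
    have h2 := (SimpleGraph.cycleGraph_connected (n := n)).dist_triangle (u := i) (v := k) (w := j)
    have h3 : (SimpleGraph.cycleGraph (n + 1)).dist k j ≤ 1 := by
      rcases n with _ | n
      · have : k = j := Fin.ext (by omega)
        simp [this]
      · have e : (SimpleGraph.cycleGraph (n + 1 + 1)).Adj k j := by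
          refine SimpleGraph.cycleGraph_adj.mpr (Or.inr ?_)
          rw [sub_eq_iff_eq_add]
          apply Fin.ext
          rw [Fin.val_add, ← h, hk]
          simp only [Fin.val_one, Nat.add_mod_mod]
          congr 1; omega
        rw [SimpleGraph.dist_eq_one_iff_adj.mpr e]
    omega

/-- Membership of a coordinate in an interval of `w` consecutive sites. -/
def InWindow (bc : BoundaryCondition) (L w : ℕ) (p q : Fin L) : Prop :=
  match bc with
  | .free => p.val ≤ q.val ∧ q.val < p.val + w
  | .periodic => ((q.val : ℤ) - (p.val : ℤ)) % (L : ℤ) < (w : ℤ)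

lemma mem_box {bc : BoundaryCondition} {L w : ℕ} {p q : Fin L × Fin L} :
    q ∈ box bc L w p ↔ InWindow bc L w p.1 q.1 ∧ InWindow bc L w p.2 q.2 := by
  cases bc <;> simp [box, InWindow]

lemma dist_line_le {bc : BoundaryCondition} {L w : ℕ} {p q q' : Fin L}
    (h : InWindow bc L w p q) (h' : InWindow bc L w p q') : (line bc L).dist q q' ≤ w := by
  cases bc
  · rcases le_total q.val q'.val with hle | hle
    · have := dist_pathGraph_le L (q'.val - q.val) q q' (by omega)
      simp only [InWindow] at h h'
      exact this.trans (by omega)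
    · have := dist_pathGraph_le L (q.val - q'.val) q' q (by omega)
      simp only [InWindow] at h h'
      rw [SimpleGraph.dist_comm]
      exact this.trans (by omega)
  · have key : ∀ q q' : Fin L,
        ((q.val : ℤ) - (p.val : ℤ)) % (L : ℤ) ≤ ((q'.val : ℤ) - (p.val : ℤ)) % (L : ℤ) →
        ((q'.val : ℤ) - (p.val : ℤ)) % (L : ℤ) < (w : ℤ) →
        (SimpleGraph.cycleGraph L).dist q q' ≤ w := by
      intro q q' hle hlt
      have hL : (0 : ℤ) < L := by have := q.isLt; omega
      have n0 := Int.emod_nonneg ((q.val : ℤ) - (p.val : ℤ)) hL.ne'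
      obtain ⟨m, hm⟩ := Int.eq_ofNat_of_zero_le (sub_nonneg.mpr hle)
      have e1 := Int.emod_add_mul_ediv ((q.val : ℤ) - (p.val : ℤ)) L
      have e2 := Int.emod_add_mul_ediv ((q'.val : ℤ) - (p.val : ℤ)) L
      -- Equal offsets from the base point differ by `m`, so walking `m` steps forward around the
      -- cycle leads from `q` to `q'`.
      have hmod : (q.val + m) % L = q'.val := by
        have : ((q.val + m : ℕ) : ℤ) = q'.val + (L : ℤ) *
            (((q.val : ℤ) - (p.val : ℤ)) / L - ((q'.val : ℤ) - (p.val : ℤ)) / L) := by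
          push_cast
          rw [mul_sub]
          linarith
        have h3 : ((q.val + m : ℕ) : ℤ) % L = (q'.val : ℤ) % L := by
          rw [this, Int.add_mul_emod_self_left]
        have h4 : (q.val + m) % L = q'.val % L := by exact_mod_cast h3
        rw [h4, Nat.mod_eq_of_lt q'.isLt]
      exact (dist_cycleGraph_le L m q q' hmod).trans (by omega)
    simp only [InWindow] at h h'
    rcases le_total (((q.val : ℤ) - (p.val : ℤ)) % (L : ℤ))
      (((q'.val : ℤ) - (p.val : ℤ)) % (L : ℤ)) with hle | hle
    · exact key q q' hle h'
    · rw [SimpleGraph.dist_comm]; exact key q' q hle h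

end Line

section Plane

variable {bc : BoundaryCondition}

lemma squareDomain_connected (n : ℕ) : (squareDomain bc (n + 1)).Connected := by
  rw [squareDomain_eq]
  exact (line_connected bc n).boxProd (line_connected bc n)

lemma squareDomain_exists_coloring (L : ℕ) (h : bc = .periodic → Even L) :
    ∃ f : Fin L × Fin L → Bool, ∀ u v, (squareDomain bc L).Adj u v → f u ≠ f v := by
  obtain ⟨f, hf⟩ := line_exists_coloring bc L h
  refine ⟨fun p => xor (f p.1) (f p.2), fun u v e => ?_⟩
  rw [squareDomain_eq, SimpleGraph.boxProd_adj] at e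
  rcases e with ⟨e, e'⟩ | ⟨e, e'⟩
  · have := hf _ _ e
    simp [e', this]
  · have := hf _ _ e
    simp [e', this]

lemma squareDomain_adj {n : ℕ} {u v : Fin (n + 2) × Fin (n + 2)}
    (h : (squareDomain bc (n + 2)).Adj u v) :
    v = u + (1, 0) ∨ v = u - (1, 0) ∨ v = u + (0, 1) ∨ v = u - (0, 1) := by
  rw [squareDomain_eq, SimpleGraph.boxProd_adj] at h
  rcases h with ⟨e, e'⟩ | ⟨e, e'⟩
  · rcases line_adj e with h | h
    · left; ext1 <;> simp [h, e']
    · right; left; ext1 <;> simp [h, e']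
  · rcases line_adj e with h | h
    · right; right; left; ext1 <;> simp [h, e']
    · right; right; right; ext1 <;> simp [h, e']

open Classical in
lemma squareDomain_card_neighbors_le {n : ℕ} (u : Fin (n + 2) × Fin (n + 2)) :
    (Finset.univ.filter fun v => (squareDomain bc (n + 2)).Adj u v).card ≤ 4 := by
  have : (Finset.univ.filter fun v => (squareDomain bc (n + 2)).Adj u v) ⊆
      {u + (1, 0), u - (1, 0), u + (0, 1), u - (0, 1)} := by
    intro v hv
    simpa using squareDomain_adj (Finset.mem_filter.mp hv).2
  exact (Finset.card_le_card this).trans Finset.card_le_four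

lemma exists_displacement_of_walk {n : ℕ} {x p : Fin (n + 2) × Fin (n + 2)}
    (w : (squareDomain bc (n + 2)).Walk x p) :
    ∃ a b : ℤ, |a| ≤ w.length ∧ |b| ≤ w.length ∧ p = x + (a • (1, 0) + b • (0, 1)) := by
  induction w with
  | nil => exact ⟨0, 0, by simp, by simp, by simp⟩
  | @cons u v q e w ih =>
    obtain ⟨a, b, ha, hb, hp⟩ := ih
    rw [SimpleGraph.Walk.length_cons]
    push_cast
    rw [abs_le] at ha hb
    rcases squareDomain_adj e with h | h | h | h
    · refine ⟨a + 1, b, abs_le.mpr ⟨by omega, by omega⟩, abs_le.mpr ⟨by omega, by omega⟩, ?_⟩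
      rw [hp, h, add_smul, one_smul]; abel
    · refine ⟨a - 1, b, abs_le.mpr ⟨by omega, by omega⟩, abs_le.mpr ⟨by omega, by omega⟩, ?_⟩
      rw [hp, h, sub_smul, one_smul]; abel
    · refine ⟨a, b + 1, abs_le.mpr ⟨by omega, by omega⟩, abs_le.mpr ⟨by omega, by omega⟩, ?_⟩
      rw [hp, h, add_smul, one_smul]; abel
    · refine ⟨a, b - 1, abs_le.mpr ⟨by omega, by omega⟩, abs_le.mpr ⟨by omega, by omega⟩, ?_⟩
      rw [hp, h, sub_smul, one_smul]; abel

open Classical in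
lemma squareDomain_card_ball_le {n : ℕ} (x : Fin (n + 2) × Fin (n + 2)) (r : ℕ) :
    (Finset.univ.filter fun p => (squareDomain bc (n + 2)).dist x p ≤ r).card ≤
      (2 * r + 1) ^ 2 := by
  have hsub : (Finset.univ.filter fun p => (squareDomain bc (n + 2)).dist x p ≤ r) ⊆
      ((Finset.Icc (-(r : ℤ)) r) ×ˢ (Finset.Icc (-(r : ℤ)) r)).image
        fun c => x + (c.1 • ((1, 0) : Fin (n + 2) × Fin (n + 2)) + c.2 • (0, 1)) := by
    intro p hp
    have hG : (squareDomain bc (n + 2)).Connected := squareDomain_connected (n + 1)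
    obtain ⟨w, hw⟩ := hG.exists_walk_length_eq_dist x p
    obtain ⟨a, b, ha, hb, hab⟩ := exists_displacement_of_walk w
    have hr := (Finset.mem_filter.mp hp).2
    rw [hw, abs_le] at ha hb
    refine Finset.mem_image.mpr ⟨(a, b), ?_, hab.symm⟩
    simp only [Finset.mem_product, Finset.mem_Icc]
    omega
  refine (Finset.card_le_card hsub).trans (Finset.card_image_le.trans ?_)
  rw [Finset.card_product, Int.card_Icc, sq]
  apply le_of_eq
  congr 1 <;> omega

lemma dist_le_of_isSquare {n k : ℕ} {s : Finset (Fin (n + 1) × Fin (n + 1))}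
    (hs : IsSquare bc (n + 1) k s) {q q' : Fin (n + 1) × Fin (n + 1)} (hq : q ∈ s)
    (hq' : q' ∈ s) : (squareDomain bc (n + 1)).dist q q' ≤ 2 ^ (k + 1) := by
  obtain ⟨⟨p, rfl⟩, -⟩ := hs
  rw [mem_box] at hq hq'
  have h1 := dist_line_le hq.1 hq'.1
  have h2 := dist_line_le hq.2 hq'.2
  have h3 : (squareDomain bc (n + 1)).dist q q' =
      (line bc (n + 1)).dist q.1 q'.1 + (line bc (n + 1)).dist q.2 q'.2 := by
    rw [squareDomain_eq]
    have c := line_connected bc n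
    have := SimpleGraph.edist_boxProd (G := line bc (n + 1)) (H := line bc (n + 1)) q q'
    rw [SimpleGraph.dist, this, ENat.toNat_add]
    · rfl
    · exact SimpleGraph.edist_ne_top_iff_reachable.mpr (c.preconnected _ _)
    · exact SimpleGraph.edist_ne_top_iff_reachable.mpr (c.preconnected _ _)
  rw [h3, pow_succ]
  omega

end Plane

/-! ### The collapsed distance to a set and the radial cut-off profile. -/

section Level

variable {V : Type*} {G : SimpleGraph V} {R : V → V → Prop} {A : Finset V}

/-- The least number of steps of a chain from `A` to `p`. -/
noncomputable def level (G : SimpleGraph V) (R : V → V → Prop) (A : Finset V) (p : V) : ℕ :=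
  sInf {n | ∃ x ∈ A, Chain G R x p n}

/-- Connectedness makes the set of chain lengths nonempty, so the infimum is attained and is not the
default value 0. -/
lemma exists_chain_level (hG : G.Connected) (hA : A.Nonempty) (p : V) :
    ∃ x ∈ A, Chain G R x p (level G R A p) := by
  obtain ⟨x, hx⟩ := hA
  obtain ⟨w⟩ := hG.preconnected x p
  exact Nat.sInf_mem (s := {n | ∃ x ∈ A, Chain G R x p n})
    ⟨_, x, hx, Chain.of_walk R .refl w⟩

lemma level_le {x p : V} {n : ℕ} (hx : x ∈ A) (h : Chain G R x p n) : level G R A p ≤ n :=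
  Nat.sInf_le ⟨x, hx, h⟩

lemma level_eq_zero {p : V} (hp : p ∈ A) : level G R A p = 0 :=
  Nat.le_zero.mp (level_le hp .refl)

lemma level_le_of_adj (hG : G.Connected) (hA : A.Nonempty) {p q : V} (e : G.Adj p q) :
    level G R A q ≤ level G R A p + 1 := by
  obtain ⟨x, hx, h⟩ := exists_chain_level (R := R) hG hA p
  exact level_le hx (h.step e)

lemma level_le_of_rel (hG : G.Connected) (hA : A.Nonempty) {p q : V} (e : R p q) :
    level G R A q ≤ level G R A p := by
  obtain ⟨x, hx, h⟩ := exists_chain_level (R := R) hG hA p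
  exact level_le hx (h.jump e)

end Level

section Profile

/-- The piecewise linear function that is `1` up to `2 ^ k` and `0` from `2 ^ (k + 1)` on. -/
noncomputable def profile (k n : ℕ) : ℝ := max 0 (min 1 (2 - (n : ℝ) / 2 ^ k))

lemma profile_of_le {k n : ℕ} (h : n ≤ 2 ^ k) : profile k n = 1 := by
  have : (n : ℝ) / 2 ^ k ≤ 1 := by
    rw [div_le_one (by positivity)]; exact_mod_cast h
  rw [profile, min_eq_left (by linarith), max_eq_right (by norm_num)]

lemma profile_of_ge {k n : ℕ} (h : 2 ^ (k + 1) ≤ n) : profile k n = 0 := by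
  have : 2 ≤ (n : ℝ) / 2 ^ k := by
    rw [le_div_iff₀ (by positivity)]
    rw [pow_succ] at h
    have : (2 ^ k * 2 : ℝ) ≤ n := by exact_mod_cast h
    linarith
  rw [profile, max_eq_left]
  exact (min_le_right _ _).trans (by linarith)

lemma sq_profile_sub_le {k n m : ℕ} (h : n ≤ m + 1) (h' : m ≤ n + 1) :
    (profile k n - profile k m) ^ 2 ≤ (1 / 2 ^ k) ^ 2 := by
  have h1 : (n : ℝ) ≤ m + 1 := by exact_mod_cast h
  have h2 : (m : ℝ) ≤ n + 1 := by exact_mod_cast h'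
  have hp : (0 : ℝ) < 2 ^ k := by positivity
  have h3 : |(2 - (n : ℝ) / 2 ^ k) - (2 - (m : ℝ) / 2 ^ k)| ≤ 1 / 2 ^ k := by
    have : (2 - (n : ℝ) / 2 ^ k) - (2 - (m : ℝ) / 2 ^ k) = (m - n) / 2 ^ k := by ring
    rw [this, abs_div, abs_of_pos hp]
    gcongr
    rw [abs_le]; constructor <;> linarith
  rw [sq_le_sq, abs_of_pos (show (0 : ℝ) < 1 / 2 ^ k by positivity)]
  refine le_trans ?_ h3
  rw [profile, profile]
  refine (abs_max_sub_max_le_max _ _ _ _).trans (max_le (by simp) ?_)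
  exact (abs_min_sub_min_le_max _ _ _ _).trans (max_le (by simp) le_rfl)

end Profile

/-! ### Additivity of the energy over functions varying on disjoint sets of edges. -/

section Energy

variable {V : Type*} [Fintype V] {G : SimpleGraph V}

lemma dirichlet_add {f g : V → ℝ} (h : ∀ p q, G.Adj p q → f p = f q ∨ g p = g q) :
    dirichlet G (f + g) = dirichlet G f + dirichlet G g := by
  classical
  unfold dirichlet
  rw [← add_div, ← Finset.sum_add_distrib]
  congr 1
  refine Finset.sum_congr rfl fun p _ => ?_
  rw [← Finset.sum_add_distrib]
  refine Finset.sum_congr rfl fun q _ => ?_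
  by_cases e : G.Adj p q
  · simp only [e, if_true, Pi.add_apply]
    rcases h p q e with h | h <;> rw [h] <;> ring
  · simp [e]

lemma dirichlet_smul (t : ℝ) (f : V → ℝ) : dirichlet G (t • f) = t ^ 2 * dirichlet G f := by
  classical
  unfold dirichlet
  rw [mul_div_assoc', Finset.mul_sum]
  congr 1
  refine Finset.sum_congr rfl fun p _ => ?_
  rw [Finset.mul_sum]
  refine Finset.sum_congr rfl fun q _ => ?_
  split_ifs
  · simp only [Pi.smul_apply, smul_eq_mul]; ring
  · simp

lemma energy_zero (β : ℝ) (ρ : V → ℤ) : energy G β 0 ρ = 0 := by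
  simp [energy, dirichlet]

lemma energy_add {β : ℝ} {ρ : V → ℤ} {f g : V → ℝ}
    (h : ∀ p q, G.Adj p q → f p = f q ∨ g p = g q) :
    energy G β (f + g) ρ = energy G β f ρ + energy G β g ρ := by
  unfold energy
  rw [dirichlet_add h]
  simp only [Pi.add_apply, add_mul, Finset.sum_add_distrib]
  ring

lemma energy_sum {ι : Type*} {β : ℝ} {ρ : V → ℤ} (T : Finset ι) (f : ι → V → ℝ)
    (h : ∀ i ∈ T, ∀ j ∈ T, i ≠ j → ∀ p q, G.Adj p q → f i p = f i q ∨ f j p = f j q) :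
    energy G β (∑ i ∈ T, f i) ρ = ∑ i ∈ T, energy G β (f i) ρ := by
  classical
  induction T using Finset.induction_on with
  | empty => simp [energy_zero]
  | insert i T hi ih =>
    rw [Finset.sum_insert hi, Finset.sum_insert hi, energy_add, ih]
    · exact fun j hj l hl => h j (Finset.mem_insert_of_mem hj) l (Finset.mem_insert_of_mem hl)
    · intro p q e
      by_cases hc : f i p = f i q
      · exact Or.inl hc
      · right
        simp only [Finset.sum_apply]
        refine Finset.sum_congr rfl fun j hj => ?_
        refine (h i (Finset.mem_insert_self _ _) j (Finset.mem_insert_of_mem hj) ?_ p q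
          e).resolve_left hc
        rintro rfl; exact hi hj

end Energy

/-! ### Islands of the support and their cut-off functions. -/

section Islands

variable {V : Type*} [Fintype V]

/-- `B` is a charged part of `ρ` of diameter at most `2 ^ (k + 1)` that is far from the rest
of `ρ`. -/
structure IsIsland (G : SimpleGraph V) (ρ : V → ℤ) (k : ℕ) (B : Finset V) : Prop where
  one_le : 1 ≤ k
  nonempty : B.Nonempty
  subset : B ⊆ supp ρ
  dist_le : ∀ x ∈ B, ∀ y ∈ B, G.dist x y ≤ 2 ^ (k + 1)
  far : ∀ x ∈ B, ∀ y ∈ supp ρ, y ∉ B → 16 * 2 ^ (k + 1) ≤ G.dist x y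
  exists_notMem : ∃ y ∈ supp ρ, y ∉ B
  charge : ∑ x ∈ B, ρ x ≠ 0

variable {G : SimpleGraph V} {R : V → V → Prop} {ρ : V → ℤ} {k k' : ℕ} {B B' : Finset V}

/-- The cut-off function of an island. -/
noncomputable def bump (G : SimpleGraph V) (R : V → V → Prop) (k : ℕ) (B : Finset V) (p : V) : ℝ :=
  profile k (level G R B p)

/-- By the factor 4, `p` is within `4 * 2^(k+1)` of `B` and within `4 * n` of `y`. The gap of `16 *
2^(k+1)` then forces `n ≥ 3 * 2^(k+1)`. -/
lemma IsIsland.lt_of_chain (hB : IsIsland G ρ k B) (hG : G.Connected)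
    (hR : ∀ x ∈ supp ρ, ∀ p n, Chain G R x p n → G.dist x p ≤ 4 * n)
    {y p : V} {n : ℕ} (hy : y ∈ supp ρ) (hyB : y ∉ B) (hc : Chain G R y p n)
    (hp : level G R B p ≤ 2 ^ (k + 1)) : 2 ^ (k + 1) < n := by
  obtain ⟨x, hx, hxc⟩ := exists_chain_level (R := R) hG hB.nonempty p
  have h1 := hR x (hB.subset hx) _ _ hxc
  have h2 := hR y hy _ _ hc
  have h3 := hG.dist_triangle (u := x) (v := p) (w := y)
  have h4 := hB.far x hx y hy hyB
  rw [SimpleGraph.dist_comm (u := p)] at h3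
  have : 0 < 2 ^ (k + 1) := by positivity
  omega

/-- Near an island, the level can be computed from all of `supp ρ` without reference to `B`. This is
what allows cut-offs of different islands to be compared. -/
lemma IsIsland.level_supp (hB : IsIsland G ρ k B) (hG : G.Connected)
    (hR : ∀ x ∈ supp ρ, ∀ p n, Chain G R x p n → G.dist x p ≤ 4 * n)
    {p : V} (hp : level G R B p ≤ 2 ^ (k + 1)) : level G R (supp ρ) p = level G R B p := by
  obtain ⟨x, hx, hxc⟩ := exists_chain_level (R := R) hG hB.nonempty p
  refine le_antisymm (level_le (hB.subset hx) hxc) ?_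
  obtain ⟨y, hy, hyc⟩ := exists_chain_level (R := R) hG (hB.nonempty.mono hB.subset) p
  by_cases hyB : y ∈ B
  · exact level_le hyB hyc
  · exact hp.trans (hB.lt_of_chain hG hR hy hyB hyc hp).le

lemma IsIsland.lt_level (hB : IsIsland G ρ k B) (hG : G.Connected)
    (hR : ∀ x ∈ supp ρ, ∀ p n, Chain G R x p n → G.dist x p ≤ 4 * n)
    {y : V} (hy : y ∈ supp ρ) (hyB : y ∉ B) : 2 ^ (k + 1) < level G R B y := by
  by_contra h
  exact absurd (hB.lt_of_chain hG hR hy hyB .refl (not_lt.mp h)) (by simp)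

lemma IsIsland.sum_bump_mul (hB : IsIsland G ρ k B) (hG : G.Connected)
    (hR : ∀ x ∈ supp ρ, ∀ p n, Chain G R x p n → G.dist x p ≤ 4 * n) :
    ∑ p, bump G R k B p * (ρ p : ℝ) = ((∑ x ∈ B, ρ x : ℤ) : ℝ) := by
  rw [Int.cast_sum, ← Finset.sum_subset (Finset.subset_univ B)]
  · refine Finset.sum_congr rfl fun x hx => ?_
    rw [bump, level_eq_zero hx, profile_of_le (by simp), one_mul]
  · intro y _ hyB
    by_cases hy : y ∈ supp ρ
    · rw [bump, profile_of_ge (hB.lt_level hG hR hy hyB).le, zero_mul]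
    · have : ρ y = 0 := by simpa [supp] using hy
      simp [this]

/-- The strict bound on the minimum matters: without it, consecutive scales could share an edge at
level `2^(k+1)`. -/
lemma IsIsland.level_of_bump_ne (hB : IsIsland G ρ k B) (hG : G.Connected) {p q : V}
    (e : G.Adj p q) (h : bump G R k B p ≠ bump G R k B q) :
    2 ^ k ≤ level G R B p ∧ level G R B p ≤ 2 ^ (k + 1) ∧
      2 ^ k ≤ level G R B q ∧ level G R B q ≤ 2 ^ (k + 1) ∧
      min (level G R B p) (level G R B q) < 2 ^ (k + 1) := by
  have h1 := level_le_of_adj (R := R) hG hB.nonempty e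
  have h2 := level_le_of_adj (R := R) hG hB.nonempty e.symm
  have h3 : ¬ (level G R B p ≤ 2 ^ k ∧ level G R B q ≤ 2 ^ k) := fun hc => h (by
    rw [bump, bump, profile_of_le hc.1, profile_of_le hc.2])
  have h4 : ¬ (2 ^ (k + 1) ≤ level G R B p ∧ 2 ^ (k + 1) ≤ level G R B q) := fun hc => h (by
    rw [bump, bump, profile_of_ge hc.1, profile_of_ge hc.2])
  omega

-- The bump varies only within distance `2 * 2^k + 8 * 2^k` of a point of `B`. That ball has at most
-- `441 * 4^k` points, each with at most 4 edges of squared gradient at most `4^(-k)`; halving `441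
-- * 4` for double counting gives 882.
open Classical in
lemma IsIsland.dirichlet_bump_le (hB : IsIsland G ρ k B) (hG : G.Connected)
    (hR : ∀ x ∈ supp ρ, ∀ p n, Chain G R x p n → G.dist x p ≤ 4 * n)
    (hdeg : ∀ u, (Finset.univ.filter fun v => G.Adj u v).card ≤ 4)
    (hball : ∀ x r, (Finset.univ.filter fun p => G.dist x p ≤ r).card ≤ (2 * r + 1) ^ 2) :
    dirichlet G (bump G R k B) ≤ 882 := by
  obtain ⟨z, hz⟩ := hB.nonempty
  have hpos : (0 : ℝ) < 2 ^ k := by positivity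
  have inner : ∀ p, (∑ q, if G.Adj p q then (bump G R k B p - bump G R k B q) ^ 2 else 0) ≤
      if G.dist z p ≤ 10 * 2 ^ k then 4 * (1 / 2 ^ k : ℝ) ^ 2 else 0 := by
    intro p
    split_ifs with hp
    · rw [← Finset.sum_filter]
      calc _ ≤ ∑ q ∈ Finset.univ.filter (fun v => G.Adj p v), (1 / 2 ^ k : ℝ) ^ 2 := by
            refine Finset.sum_le_sum fun q hq => ?_
            have e := (Finset.mem_filter.mp hq).2
            exact sq_profile_sub_le (level_le_of_adj hG hB.nonempty e.symm)
              (level_le_of_adj hG hB.nonempty e)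
        _ ≤ _ := by
            rw [Finset.sum_const, nsmul_eq_mul]
            have : (((Finset.univ.filter fun v => G.Adj p v).card : ℕ) : ℝ) ≤ 4 := by
              exact_mod_cast hdeg p
            gcongr
    · refine le_of_eq (Finset.sum_eq_zero fun q _ => ?_)
      split_ifs with e
      · by_contra hne
        have hne' : bump G R k B p ≠ bump G R k B q := fun h => hne (by simp [h])
        obtain ⟨-, h1, -⟩ := hB.level_of_bump_ne hG e hne'
        obtain ⟨x, hx, hxc⟩ := exists_chain_level (R := R) hG hB.nonempty p
        have h2 := hR x (hB.subset hx) _ _ hxc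
        have h3 := hB.dist_le z hz x hx
        have h4 := hG.dist_triangle (u := z) (v := x) (w := p)
        rw [pow_succ] at h1 h3
        omega
      · rfl
  have hcard : (((Finset.univ.filter fun p => G.dist z p ≤ 10 * 2 ^ k).card : ℕ) : ℝ) ≤
      441 * (2 ^ k) ^ 2 := by
    have h1 : (((Finset.univ.filter fun p => G.dist z p ≤ 10 * 2 ^ k).card : ℕ) : ℝ) ≤
        (2 * (10 * 2 ^ k) + 1) ^ 2 := by exact_mod_cast hball z (10 * 2 ^ k)
    have h2 : (1 : ℝ) ≤ 2 ^ k := one_le_pow₀ (by norm_num)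
    nlinarith
  have houter : (∑ p, ∑ q, if G.Adj p q then (bump G R k B p - bump G R k B q) ^ 2 else 0) ≤
      1764 := by
    refine (Finset.sum_le_sum fun p _ => inner p).trans ?_
    rw [← Finset.sum_filter, Finset.sum_const, nsmul_eq_mul]
    calc _ ≤ 441 * ((2 : ℝ) ^ k) ^ 2 * (4 * (1 / 2 ^ k) ^ 2) := by gcongr
      _ = 1764 := by field_simp; norm_num
  unfold dirichlet
  rw [div_le_iff₀ (by norm_num)]
  refine le_trans (le_of_eq ?_) (houter.trans (by norm_num))
  rfl

/-- Bumps of different islands do not vary along the same edge. -/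
lemma IsIsland.eq_of_bump_ne (hB : IsIsland G ρ k B) (hB' : IsIsland G ρ k' B') (hG : G.Connected)
    (hR : ∀ x ∈ supp ρ, ∀ p n, Chain G R x p n → G.dist x p ≤ 4 * n) {p q : V} (e : G.Adj p q)
    (h : bump G R k B p ≠ bump G R k B q) (h' : bump G R k' B' p ≠ bump G R k' B' q) :
    k = k' ∧ B = B' := by
  obtain ⟨a1, a2, a3, a4, a5⟩ := hB.level_of_bump_ne hG e h
  obtain ⟨b1, b2, b3, b4, b5⟩ := hB'.level_of_bump_ne hG e h'
  have a6 := hB.level_supp hG hR a2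
  have a7 := hB.level_supp hG hR a4
  have b6 := hB'.level_supp hG hR b2
  have b7 := hB'.level_supp hG hR b4
  -- Both levels equal the level from `supp ρ`, so the dyadic ranges `[2^k, 2^(k+1)]` and `[2^k',
  -- 2^(k'+1)]` overlap in more than an endpoint.
  have hk : k = k' := by
    have h1 : k < k' + 1 := (Nat.pow_lt_pow_iff_right (a := 2) (by norm_num)).mp (by omega)
    have h2 : k' < k + 1 := (Nat.pow_lt_pow_iff_right (a := 2) (by norm_num)).mp (by omega)
    omega
  subst hk
  refine ⟨rfl, ?_⟩
  obtain ⟨x, hx, hxc⟩ := exists_chain_level (R := R) hG hB'.nonempty p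
  have hxB : x ∈ B := by
    by_contra hxB
    have := hB.lt_of_chain hG hR (hB'.subset hx) hxB hxc a2
    omega
  have hpos : 0 < 2 ^ (k + 1) := by positivity
  ext y
  constructor
  · intro hy
    by_contra hyB
    have := hB'.far x hx y (hB.subset hy) hyB
    have := hB.dist_le x hxB y hy
    omega
  · intro hy
    by_contra hyB
    have := hB.far x hxB y (hB'.subset hy) hyB
    have := hB'.dist_le x hx y hy
    omega

/-- The bump of an island is constant along the edges at the support of `ρ`. -/
lemma IsIsland.bump_eq_of_mem (hB : IsIsland G ρ k B) (hG : G.Connected)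
    (hR : ∀ x ∈ supp ρ, ∀ p n, Chain G R x p n → G.dist x p ≤ 4 * n) {p q : V} (e : G.Adj p q)
    (hp : p ∈ supp ρ) : bump G R k B p = bump G R k B q := by
  by_contra h
  obtain ⟨a1, a2, -⟩ := hB.level_of_bump_ne hG e h
  have := hB.level_supp hG hR a2
  rw [level_eq_zero hp] at this
  have : 0 < 2 ^ k := by positivity
  omega

/-- The bump reaches less than a quarter of the way from the island to the rest of `supp ρ`, which
keeps its support well inside `D(ρ)`. -/
lemma IsIsland.dist_add_le_of_bump_ne_zero (hB : IsIsland G ρ k B) (hG : G.Connected)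
    (hR : ∀ x ∈ supp ρ, ∀ p n, Chain G R x p n → G.dist x p ≤ 4 * n) {p : V}
    (h : bump G R k B p ≠ 0) :
    ∃ x ∈ supp ρ, ∃ y ∈ supp ρ, 4 * G.dist x p + 16 ≤ G.dist x y := by
  have h1 : level G R B p < 2 ^ (k + 1) := by
    by_contra hc
    exact h (profile_of_ge (not_lt.mp hc))
  obtain ⟨x, hx, hxc⟩ := exists_chain_level (R := R) hG hB.nonempty p
  obtain ⟨y, hy, hyB⟩ := hB.exists_notMem
  refine ⟨x, hB.subset hx, y, hy, ?_⟩
  have h2 := hR x (hB.subset hx) _ _ hxc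
  have h3 := hB.far x hx y hy hyB
  omega

end Islands

/-! ### The one-coloured wave giving the norm term. -/

section BaseWave

variable {V : Type*} [Fintype V] {G : SimpleGraph V} {f : V → Bool}

lemma norm₂_sq (ρ : V → ℤ) : norm₂ ρ ^ 2 = ∑ p, (ρ p : ℝ) ^ 2 :=
  Real.sq_sqrt (Finset.sum_nonneg fun _ _ => sq_nonneg _)

/-- The density restricted to one of the two colour classes. -/
def colorPart (f : V → Bool) (b : Bool) (ρ : V → ℤ) (p : V) : ℝ :=
  if f p = b then (ρ p : ℝ) else 0

lemma exists_half_le_sum_sq (f : V → Bool) (ρ : V → ℤ) :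
    ∃ b, ∑ p, (ρ p : ℝ) ^ 2 ≤ 2 * ∑ p, colorPart f b ρ p ^ 2 := by
  have h : ∑ p, (ρ p : ℝ) ^ 2 =
      ∑ p, colorPart f true ρ p ^ 2 + ∑ p, colorPart f false ρ p ^ 2 := by
    rw [← Finset.sum_add_distrib]
    refine Finset.sum_congr rfl fun p _ => ?_
    unfold colorPart
    cases f p <;> simp
  rcases le_total (∑ p, colorPart f true ρ p ^ 2) (∑ p, colorPart f false ρ p ^ 2) with h' | h'
  · exact ⟨false, by linarith⟩
  · exact ⟨true, by linarith⟩

open Classical in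
lemma dirichlet_colorPart_le (hf : ∀ u v, G.Adj u v → f u ≠ f v)
    (hdeg : ∀ u, (Finset.univ.filter fun v => G.Adj u v).card ≤ 4) (b : Bool) (ρ : V → ℤ) :
    dirichlet G (colorPart f b ρ) ≤ 4 * ∑ p, colorPart f b ρ p ^ 2 := by
  set a := colorPart f b ρ with ha
  -- Adjacent points have different colours, so at most one endpoint of an edge contributes and the
  -- cross term vanishes.
  have h1 : ∀ p q, (if G.Adj p q then (a p - a q) ^ 2 else 0) =
      (if G.Adj p q then a p ^ 2 else 0) + (if G.Adj q p then a q ^ 2 else 0) := by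
    intro p q
    by_cases e : G.Adj p q
    · have : a p = 0 ∨ a q = 0 := by
        by_cases hp : f p = b
        · right
          have : f q ≠ b := fun hq => hf p q e (hp.trans hq.symm)
          simp [ha, colorPart, this]
        · left; simp [ha, colorPart, hp]
      simp only [e, e.symm, if_true]
      rcases this with h | h <;> rw [h] <;> ring
    · have e' : ¬ G.Adj q p := fun h => e h.symm
      simp [e, e']
  have h2 : ∀ p, (∑ q, if G.Adj p q then a p ^ 2 else 0) ≤ 4 * a p ^ 2 := by
    intro p
    rw [← Finset.sum_filter, Finset.sum_const, nsmul_eq_mul]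
    have : (((Finset.univ.filter fun v => G.Adj p v).card : ℕ) : ℝ) ≤ 4 := by
      exact_mod_cast hdeg p
    gcongr
  have h3 : ∑ p, (∑ q, if G.Adj p q then a p ^ 2 else 0) ≤ 4 * ∑ p, a p ^ 2 := by
    rw [Finset.mul_sum]
    exact Finset.sum_le_sum fun p _ => h2 p
  have h4 : ∑ p, ∑ q, (if G.Adj p q then (a p - a q) ^ 2 else 0) ≤ 8 * ∑ p, a p ^ 2 := by
    simp only [h1, Finset.sum_add_distrib]
    rw [Finset.sum_comm (f := fun p q => if G.Adj q p then a q ^ 2 else 0)]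
    linarith
  unfold dirichlet
  rw [div_le_iff₀ (by norm_num)]
  refine le_trans (le_of_eq rfl) (h4.trans (by linarith))

open Classical in
lemma energy_colorPart_ge (hf : ∀ u v, G.Adj u v → f u ≠ f v)
    (hdeg : ∀ u, (Finset.univ.filter fun v => G.Adj u v).card ≤ 4) {β : ℝ} (hβ : 0 < β)
    {b : Bool} {ρ : V → ℤ}
    (hb : ∑ p, (ρ p : ℝ) ^ 2 ≤ 2 * ∑ p, colorPart f b ρ p ^ 2) :
    1 / β * (1 / 16 * norm₂ ρ ^ 2) ≤ energy G β ((1 / (4 * β)) • colorPart f b ρ) ρ := by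
  rw [norm₂_sq]
  have h1 := dirichlet_colorPart_le hf hdeg b ρ
  have h2 : ∑ p, ((1 / (4 * β)) • colorPart f b ρ) p * (ρ p : ℝ) =
      1 / (4 * β) * ∑ p, colorPart f b ρ p ^ 2 := by
    rw [Finset.mul_sum]
    refine Finset.sum_congr rfl fun p _ => ?_
    simp only [Pi.smul_apply, smul_eq_mul, colorPart]
    split_ifs <;> ring
  rw [energy, h2, dirichlet_smul]
  set X := ∑ p, colorPart f b ρ p ^ 2
  set Y := ∑ p, (ρ p : ℝ) ^ 2
  -- The coefficient `t = 1/(4β)` maximises `t * X - (β/2) * t^2 * 4X`.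
  calc 1 / β * (1 / 16 * Y) ≤ 1 / β * (1 / 16 * (2 * X)) := by gcongr
    _ = 1 / (4 * β) * X - β / 2 * ((1 / (4 * β)) ^ 2 * (4 * X)) := by field_simp; ring
    _ ≤ _ := by gcongr

end BaseWave

/-! ### Assembly of the spin wave. -/

section Wave

variable {V : Type*} [Fintype V] {G : SimpleGraph V} {ρ : V → ℤ}

lemma mem_supp {p : V} : p ∈ supp ρ ↔ ρ p ≠ 0 := by simp [supp]

lemma dist_le_diam {p q : V} (hp : p ∈ supp ρ) (hq : q ∈ supp ρ) : G.dist p q ≤ diam G ρ :=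
  Finset.le_sup (f := fun p : V × V => G.dist p.1 p.2) (Finset.mk_mem_product hp hq)

lemma diam_pos (hG : G.Connected) (h0 : ρ ≠ 0) (hρ : charge ρ = 0) : 1 ≤ diam G ρ := by
  by_contra hd
  obtain ⟨p, hp⟩ := Function.ne_iff.mp h0
  have hp' : p ∈ supp ρ := mem_supp.mpr hp
  apply hp
  rw [charge, Finset.sum_eq_single p] at hρ
  · exact hρ
  · intro q _ hq
    by_contra hq0
    have h1 := dist_le_diam (G := G) (mem_supp.mpr hq0) hp'
    exact hq (hG.dist_eq_zero_iff.mp (by omega))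
  · simp

lemma sum_sq_eq_sq_sum {s : V → ℝ} (h : ∀ p q, s p ≠ 0 → s q ≠ 0 → p = q) :
    ∑ p, s p ^ 2 = (∑ p, s p) ^ 2 := by
  classical
  by_cases hs : ∃ p, s p ≠ 0
  · obtain ⟨p, hp⟩ := hs
    have : ∀ q, q ≠ p → s q = 0 := fun q hq => by
      by_contra h'; exact hq (h q p h' hp)
    rw [Finset.sum_eq_single p, Finset.sum_eq_single p]
    · exact fun q _ hq => this q hq
    · simp
    · exact fun q _ hq => by simp [this q hq]
    · simp
  · push Not at hs
    simp [hs]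

lemma adj_of_diam_eq_one (hG : G.Connected) (hd : diam G ρ = 1) {p q : V} (hp : ρ p ≠ 0)
    (hq : ρ q ≠ 0) (hne : p ≠ q) : G.Adj p q := by
  have h1 := dist_le_diam (G := G) (mem_supp.mpr hp) (mem_supp.mpr hq)
  have h2 : G.dist p q ≠ 0 := fun h => hne (hG.dist_eq_zero_iff.mp h)
  exact SimpleGraph.dist_eq_one_iff_adj.mp (by omega)

/-- There is a colour class carrying half of the norm, and it can be taken to be the class of a
given point of the support if the density is a dipole. -/
lemma exists_color (hG : G.Connected) {f : V → Bool} (hf : ∀ u v, G.Adj u v → f u ≠ f v)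
    (hρ : charge ρ = 0) (c : V) :
    ∃ b, ∑ p, (ρ p : ℝ) ^ 2 ≤ 2 * ∑ p, colorPart f b ρ p ^ 2 ∧ (diam G ρ = 1 → b = f c) := by
  by_cases hd : diam G ρ = 1
  -- For diameter 1 the support is a clique in a bipartite graph, hence at most one point of each
  -- colour. By neutrality the two charges are opposite, so either colour carries exactly half the
  -- norm.
  · refine ⟨f c, ?_, fun _ => rfl⟩
    have hu : ∀ b p q, colorPart f b ρ p ≠ 0 → colorPart f b ρ q ≠ 0 → p = q := by
      intro b p q hp hq
      simp only [colorPart, ne_eq, ite_eq_right_iff, not_forall, Int.cast_eq_zero] at hp hq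
      obtain ⟨hp1, hp2⟩ := hp
      obtain ⟨hq1, hq2⟩ := hq
      by_contra hne
      exact hf p q (adj_of_diam_eq_one hG hd hp2 hq2 hne) (hp1.trans hq1.symm)
    have hsplit : ∀ p, (ρ p : ℝ) = colorPart f (f c) ρ p + colorPart f (!f c) ρ p := by
      intro p
      unfold colorPart
      cases f p <;> cases f c <;> simp
    have hsq : ∑ p, (ρ p : ℝ) ^ 2 =
        ∑ p, colorPart f (f c) ρ p ^ 2 + ∑ p, colorPart f (!f c) ρ p ^ 2 := by
      rw [← Finset.sum_add_distrib]
      refine Finset.sum_congr rfl fun p _ => ?_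
      unfold colorPart
      cases f p <;> cases f c <;> simp
    have hsum : ∑ p, colorPart f (f c) ρ p + ∑ p, colorPart f (!f c) ρ p = 0 := by
      rw [← Finset.sum_add_distrib, ← Finset.sum_congr rfl fun p _ => hsplit p]
      exact_mod_cast hρ
    rw [hsq, sum_sq_eq_sq_sum (hu _), sum_sq_eq_sq_sum (hu _)]
    have := eq_neg_of_add_eq_zero_right hsum
    rw [this]
    linarith [neg_sq (∑ p, colorPart f (f c) ρ p)]
  · obtain ⟨b, hb⟩ := exists_half_le_sum_sq f ρ
    exact ⟨b, hb, fun h => absurd h hd⟩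

open Classical in
/-- The spin wave of a neutral density with a given family of islands. -/
theorem exists_wave (hG : G.Connected) {f : V → Bool} (hf : ∀ u v, G.Adj u v → f u ≠ f v)
    (hdeg : ∀ u, (Finset.univ.filter fun v => G.Adj u v).card ≤ 4)
    (hball : ∀ x r, (Finset.univ.filter fun p => G.dist x p ≤ r).card ≤ (2 * r + 1) ^ 2)
    {β : ℝ} (hβ : 0 < β) (h0 : ρ ≠ 0) (hρ : charge ρ = 0) {c : V} (hc : c ∈ supp ρ)
    {R : V → V → Prop} (hsymm : ∀ p q, R p q → R q p) (hout : ∀ p q, R p q → p ∉ supp ρ)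
    (hR : ∀ x ∈ supp ρ, ∀ p n, Chain G R x p n → G.dist x p ≤ 4 * n)
    (T : Finset (ℕ × Finset V)) (hT : ∀ i ∈ T, IsIsland G ρ i.1 i.2) :
    ∃ a : V → ℝ, (∀ p q, R p q → a p = a q) ∧
      (∀ p, a p ≠ 0 → G.dist p c + 2 ≤ 2 * diam G ρ) ∧
      1 / β * (1 / 16 * norm₂ ρ ^ 2 + 1 / 1764 * (T.card : ℝ)) ≤ energy G β a ρ := by
  obtain ⟨b, hb, hbc⟩ := exists_color hG hf hρ c
  have hd := diam_pos hG h0 hρ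
  set a₀ : V → ℝ := (1 / (4 * β)) • colorPart f b ρ with ha₀
  have ha₀_supp : ∀ p, a₀ p ≠ 0 → p ∈ supp ρ ∧ f p = b := by
    intro p hp
    simp only [ha₀, Pi.smul_apply, smul_eq_mul, colorPart, mul_ite, mul_zero, ne_eq,
      ite_eq_right_iff, not_forall, mul_eq_zero, not_or, Int.cast_eq_zero] at hp
    exact ⟨mem_supp.mpr hp.2.2, hp.1⟩
  -- The factor `1/(882β)` maximises `t - (β/2) * t^2 * 882`, with value `1/(1764β)`; the sign makes
  -- the pairing with the charge positive.
  set g : ℕ × Finset V → V → ℝ := fun i =>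
    (1 / (882 * β) * SignType.sign (((∑ x ∈ i.2, ρ x : ℤ) : ℝ))) • bump G R i.1 i.2 with hg
  have hg_ne : ∀ i p q, g i p ≠ g i q → bump G R i.1 i.2 p ≠ bump G R i.1 i.2 q := by
    intro i p q h h'
    exact h (by simp [hg, h'])
  refine ⟨a₀ + ∑ i ∈ T, g i, ?_, ?_, ?_⟩
  · intro p q e
    have h1 : a₀ p = 0 := by
      by_contra h; exact hout p q e (ha₀_supp p h).1
    have h2 : a₀ q = 0 := by
      by_contra h; exact hout q p (hsymm p q e) (ha₀_supp q h).1
    simp only [Pi.add_apply, h1, h2, Finset.sum_apply]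
    congr 1
    refine Finset.sum_congr rfl fun i hi => ?_
    have h3 : level G R i.2 p = level G R i.2 q :=
      le_antisymm (level_le_of_rel hG (hT i hi).nonempty (hsymm p q e))
        (level_le_of_rel hG (hT i hi).nonempty e)
    simp only [hg, Pi.smul_apply, bump, h3]
  · intro p hp
    by_cases h : a₀ p = 0
    · have h1 : ∑ i ∈ T, g i p ≠ 0 := by
        simpa [h] using hp
      obtain ⟨i, hi, hip⟩ := Finset.exists_ne_zero_of_sum_ne_zero h1
      have h2 : bump G R i.1 i.2 p ≠ 0 := fun h' => hip (by simp [hg, h'])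
      obtain ⟨x, hx, y, hy, hxy⟩ := (hT i hi).dist_add_le_of_bump_ne_zero hG hR h2
      have h3 := dist_le_diam (G := G) hx hy
      have h4 := dist_le_diam (G := G) hx hc
      have h5 := hG.dist_triangle (u := p) (v := x) (w := c)
      rw [SimpleGraph.dist_comm (u := p) (v := x)] at h5
      omega
    · obtain ⟨h1, h2⟩ := ha₀_supp p h
      have h3 := dist_le_diam (G := G) h1 hc
      -- The required margin of 2, which later accommodates the Laplacian, follows from `dist ≤ d`
      -- only when `d ≥ 2`. For `d = 1` the choice of colour leaves the centre as the only point.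
      by_cases hd1 : diam G ρ = 1
      · have : p = c := by
          by_contra hne
          exact hf p c (adj_of_diam_eq_one hG hd1 (mem_supp.mp h1) (mem_supp.mp hc) hne)
            (h2.trans (hbc hd1))
        simp [this, hd1]
      · omega
  · have e0 := energy_colorPart_ge (G := G) hf hdeg hβ hb
    have e1 : ∀ i ∈ T, 1 / (1764 * β) ≤ energy G β (g i) ρ := by
      intro i hi
      have h1 := (hT i hi).dirichlet_bump_le hG hR hdeg hball
      have h2 := (hT i hi).sum_bump_mul hG hR
      have h3 := (hT i hi).charge
      have h4 : (1 : ℝ) ≤ |((∑ x ∈ i.2, ρ x : ℤ) : ℝ)| := by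
        exact_mod_cast Int.one_le_abs h3
      have h5 : ∑ p, g i p * (ρ p : ℝ) = 1 / (882 * β) * |((∑ x ∈ i.2, ρ x : ℤ) : ℝ)| := by
        rw [← sign_mul_self, ← mul_assoc, ← h2, Finset.mul_sum]
        refine Finset.sum_congr rfl fun p _ => ?_
        simp only [hg, h2, Pi.smul_apply, smul_eq_mul]
        ring
      have h6 : (SignType.sign (((∑ x ∈ i.2, ρ x : ℤ) : ℝ)) : ℝ) ^ 2 = 1 := by
        rcases lt_trichotomy (((∑ x ∈ i.2, ρ x : ℤ) : ℝ)) 0 with h | h | h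
        · rw [sign_neg h]; simp
        · rw [h] at h4; norm_num at h4
        · rw [sign_pos h]; simp
      rw [energy, h5]
      simp only [hg]
      rw [dirichlet_smul, mul_pow, h6]
      set X := dirichlet G (bump G R i.1 i.2)
      set Y := |((∑ x ∈ i.2, ρ x : ℤ) : ℝ)|
      calc 1 / (1764 * β) = 1 / (882 * β) * 1 - β / 2 * ((1 / (882 * β)) ^ 2 * 1 * 882) := by
            field_simp; norm_num
        _ ≤ _ := by gcongr
    rw [energy_add, energy_sum]
    · have e2 := Finset.sum_le_sum e1
      rw [Finset.sum_const, nsmul_eq_mul] at e2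
      calc _ = 1 / β * (1 / 16 * norm₂ ρ ^ 2) + T.card * (1 / (1764 * β)) := by
            field_simp
        _ ≤ _ := add_le_add e0 e2
    · intro i hi j hj hij p q e
      by_contra! h
      obtain ⟨h1, h2⟩ := (hT i hi).eq_of_bump_ne (hT j hj) hG hR e (hg_ne i p q h.1)
        (hg_ne j p q h.2)
      exact hij (Prod.ext h1 h2)
    · intro p q e
      by_contra! h
      obtain ⟨h1, h2⟩ := h
      simp only [Finset.sum_apply] at h2
      have : ∃ i ∈ T, g i p ≠ g i q := by
        by_contra! h3
        exact h2 (Finset.sum_congr rfl h3)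
      obtain ⟨i, hi, hne⟩ := this
      have hb' := hg_ne i p q hne
      by_cases hp : a₀ p = 0
      · have hq : a₀ q ≠ 0 := fun hq => h1 (hp.trans hq.symm)
        exact hb' ((hT i hi).bump_eq_of_mem hG hR e.symm (ha₀_supp q hq).1).symm
      · exact hb' ((hT i hi).bump_eq_of_mem hG hR e (ha₀_supp p hp).1)

end Wave

/-! ### Numerical consequences of `3/2 < α < 2`. -/

section Exponent

variable {α : ℝ}

lemma natCast_le_rpow (hα : 3 / 2 < α) (n : ℕ) : (n : ℝ) ≤ (n : ℝ) ^ α := by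
  rcases Nat.eq_zero_or_pos n with rfl | hn
  · rw [Nat.cast_zero, Real.zero_rpow (by linarith)]
  · exact Real.self_le_rpow_of_one_le (by exact_mod_cast hn) (by linarith)

/-- The rate `14/5` is admissible because `(14/5)^2 < 8 = (2^(3/2))^2`. -/
lemma pow_le_two_pow_rpow (hα : 3 / 2 < α) (m : ℕ) : (14 / 5 : ℝ) ^ m ≤ ((2 : ℝ) ^ m) ^ α := by
  have h1 : (14 / 5 : ℝ) ≤ 2 ^ α := by
    have h2 : (2 : ℝ) ^ (3 / 2 : ℝ) ≤ 2 ^ α :=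
      Real.rpow_le_rpow_of_exponent_le (by norm_num) hα.le
    have h3 : ((2 : ℝ) ^ (3 / 2 : ℝ)) ^ 2 = 8 := by
      rw [← Real.rpow_natCast, ← Real.rpow_mul (by norm_num)]; norm_num
    have h4 : (0 : ℝ) < (2 : ℝ) ^ (3 / 2 : ℝ) := by positivity
    nlinarith
  rw [← Real.rpow_natCast 2 m, ← Real.rpow_mul (by norm_num), mul_comm, Real.rpow_mul (by norm_num),
    Real.rpow_natCast]
  exact pow_le_pow_left₀ (by norm_num) h1 m

lemma pow_le_rpow (hα : 3 / 2 < α) {m n : ℕ} (h : 2 ^ m ≤ n) :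
    (14 / 5 : ℝ) ^ m ≤ (n : ℝ) ^ α := by
  refine (pow_le_two_pow_rpow hα m).trans ?_
  exact Real.rpow_le_rpow (by positivity) (by exact_mod_cast h) (by linarith)

lemma pow_le_four_mul_rpow (hα : 3 / 2 < α) (hα' : α < 2) {m n : ℕ} (h : 2 ^ m ≤ 2 * n) :
    (14 / 5 : ℝ) ^ m ≤ 4 * (n : ℝ) ^ α := by
  have h1 := pow_le_rpow hα h
  push_cast at h1
  rw [Real.mul_rpow (by norm_num) (by positivity)] at h1
  have h2 : (2 : ℝ) ^ α ≤ 2 ^ (2 : ℝ) := Real.rpow_le_rpow_of_exponent_le (by norm_num) hα'.le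
  have h3 : (2 : ℝ) ^ (2 : ℝ) = 4 := by norm_num
  rw [h3] at h2
  exact h1.trans (by gcongr)

end Exponent

section Sets

variable {V : Type*} {G : SimpleGraph V}

lemma setDist_le {A B : Finset V} {x y : V} (hx : x ∈ A) (hy : y ∈ B) :
    setDist G A B ≤ G.dist x y :=
  Nat.sInf_le ⟨x, hx, y, hy, rfl⟩

lemma exists_dist_eq_setDist {A B : Finset V} (hA : A.Nonempty) (hB : B.Nonempty) :
    ∃ x ∈ A, ∃ y ∈ B, G.dist x y = setDist G A B := by
  obtain ⟨x, hx⟩ := hA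
  obtain ⟨y, hy⟩ := hB
  exact Nat.sInf_mem (s := {n | ∃ i ∈ A, ∃ j ∈ B, G.dist i j = n}) ⟨_, x, hx, y, hy, rfl⟩

end Sets

/-! ### Sparsity of the obstacles and nonzero charge of the islands. -/

section Obstacles

variable {V : Type*} [Fintype V] {G : SimpleGraph V} {center : (V → ℤ) → V} {α : ℝ}
  {N : Finset (V → ℤ)} {ρ : V → ℤ}

lemma dist_center_le_of_mem_DPlus (hG : G.Connected) {z : V} (hz : z ∈ DPlus G center ρ) :
    G.dist z (center ρ) ≤ 2 * diam G ρ := by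
  obtain ⟨i, hi, hzi⟩ := hz
  have := hG.dist_triangle (u := z) (v := i) (w := center ρ)
  have hi : G.dist i (center ρ) < 2 * diam G ρ := hi
  omega

lemma IsSeparated.le_dist (hsep : IsSeparated G α N) {ρ₁ ρ₂ : V → ℤ} (h₁ : ρ₁ ∈ N) (h₂ : ρ₂ ∈ N)
    (hne : ρ₁ ≠ ρ₂) {x y : V} (hx : x ∈ supp ρ₁) (hy : y ∈ supp ρ₂) :
    65536 * ((min (diam G ρ₁) (diam G ρ₂) : ℕ) : ℝ) ^ α ≤ G.dist x y := by
  refine le_trans ?_ ((hsep.far ρ₁ h₁ ρ₂ h₂ hne).trans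
    (by exact_mod_cast setDist_le (G := G) hx hy))
  rw [M]
  norm_num

lemma mem_smaller {N₀ : Finset (V → ℤ)} {ρ' : V → ℤ} :
    ρ' ∈ smaller G N₀ ρ ↔ ρ' ∈ N₀ ∧ diam G ρ' ≤ 2 * diam G ρ ∧ ρ ≠ ρ' := by
  simp [smaller]

lemma mem_neutral : ρ ∈ neutral N ↔ ρ ∈ N ∧ charge ρ = 0 := by simp [neutral]

/-- Two points of a common set `D⁺(ρ')`. -/
def SameObstacle (G : SimpleGraph V) (center : (V → ℤ) → V) (F : Finset (V → ℤ)) (p q : V) :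
    Prop :=
  ∃ ρ' ∈ F, p ∈ DPlus G center ρ' ∧ q ∈ DPlus G center ρ'

lemma isSparse_smaller (hG : G.Connected) (hα : 3 / 2 < α) (hcenter : IsCenterChoice G center)
    (hN : IsEnsemble N) (hsep : IsSeparated G α N) (ρ : V → ℤ) :
    IsSparse G (fun i : smaller G (neutral N) ρ => DPlus G center i.1) (fun i => center i.1)
      (fun i => diam G i.1) where
  dist_center i z hz := dist_center_le_of_mem_DPlus hG hz
  center_mem i := by
    have hi := mem_neutral.mp (mem_smaller.mp i.2).1
    have := diam_pos hG (hN.1 _ hi.1) hi.2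
    refine ⟨center i.1, ?_, by simp⟩
    show G.dist _ _ < _
    simp only [SimpleGraph.dist_self]
    omega
  pos i := by
    have hi := mem_neutral.mp (mem_smaller.mp i.2).1
    exact diam_pos hG (hN.1 _ hi.1) hi.2
  separated i j hij m hi hj := by
    have h1 := (mem_neutral.mp (mem_smaller.mp i.2).1).1
    have h2 := (mem_neutral.mp (mem_smaller.mp j.2).1).1
    refine le_trans ?_ (hsep.le_dist h1 h2 (fun h => hij (Subtype.ext h))
      (hcenter _ (hN.1 _ h1)).1 (hcenter _ (hN.1 _ h2)).1)
    have := pow_le_rpow hα (le_min hi hj)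
    gcongr

lemma dist_le_of_chain_sameObstacle (hG : G.Connected) (hα : 3 / 2 < α) (hα' : α < 2)
    (hcenter : IsCenterChoice G center) (hN : IsEnsemble N) (hsep : IsSeparated G α N)
    (hρ : ρ ∈ N) {x : V} (hx : x ∈ supp ρ) (p : V) (n : ℕ)
    (hc : Chain G (SameObstacle G center (smaller G (neutral N) ρ)) x p n) :
    G.dist x p ≤ 4 * n := by
  set F := smaller G (neutral N) ρ with hF
  refine dist_le_four_mul hG (isSparse_smaller hG hα hcenter hN hsep ρ) ?_
    -- Any `m` with all diameters below `2^m` will do; `d < 2^d` makes the maximal diameter such an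
    -- `m`.
    (F.sup (diam G)) p n ?_
  · rintro ⟨ρ', hρ'⟩ m hm
    obtain ⟨h1, h2, h3⟩ := mem_smaller.mp hρ'
    have h4 := (mem_neutral.mp h1).1
    have h5 := hsep.le_dist hρ h4 h3 hx (hcenter _ (hN.1 _ h4)).1
    -- An obstacle may have up to twice the diameter of `ρ`. This costs a factor `2^α < 4` and
    -- explains the constant `16384 = 65536 / 4`.
    have h6 : 2 ^ m ≤ 2 * min (diam G ρ) (diam G ρ') := by
      simp only at hm
      omega
    have h7 := pow_le_four_mul_rpow hα hα' h6
    refine le_trans ?_ h5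
    linarith
  · induction hc with
    | refl => exact .refl
    | step _ e ih => exact ih.step e
    | jump _ e ih =>
      obtain ⟨ρ', hρ', hp, hq⟩ := e
      refine ih.jump ⟨⟨ρ', hρ'⟩, ?_, hp, hq⟩
      exact (Finset.le_sup (f := diam G) hρ').trans_lt Nat.lt_two_pow_self

lemma notMem_supp_of_mem_DPlus (hG : G.Connected) (hα : 3 / 2 < α)
    (hcenter : IsCenterChoice G center) (hN : IsEnsemble N) (hsep : IsSeparated G α N)
    (hρ : ρ ∈ N) {ρ' : V → ℤ} (hρ' : ρ' ∈ smaller G (neutral N) ρ) {p : V}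
    (hp : p ∈ DPlus G center ρ') : p ∉ supp ρ := by
  intro hps
  obtain ⟨h1, h2, h3⟩ := mem_smaller.mp hρ'
  obtain ⟨h4, h4'⟩ := mem_neutral.mp h1
  have h5 := hsep.le_dist hρ h4 h3 hps (hcenter _ (hN.1 _ h4)).1
  have h6 := natCast_le_rpow hα (min (diam G ρ) (diam G ρ'))
  have h7 : 65536 * ((min (diam G ρ) (diam G ρ') : ℕ) : ℝ) ≤ G.dist p (center ρ') := by linarith
  have h8 : 65536 * min (diam G ρ) (diam G ρ') ≤ G.dist p (center ρ') := by exact_mod_cast h7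
  have h9 := dist_center_le_of_mem_DPlus hG hp
  have h10 := diam_pos hG (hN.1 _ h4) h4'
  omega

/-- A far away part of diameter at most `2 ^ (k + 1)` of a neutral density of a separated ensemble
is an island. -/
lemma IsSeparated.isIsland (hsep : IsSeparated G α N) (hα : 3 / 2 < α) (hρ : ρ ∈ N)
    (hcharge : charge ρ = 0) {k : ℕ} (hk : 1 ≤ k) {B : Finset V} (hB : B.Nonempty)
    (hBs : B ⊆ supp ρ) (hBd : ∀ x ∈ B, ∀ y ∈ B, G.dist x y ≤ 2 ^ (k + 1))
    (hfar : ∀ x ∈ B, ∀ y ∈ supp ρ, y ∉ B →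
      2 * M * (2 : ℝ) ^ (α * ((k : ℝ) + 1)) ≤ G.dist x y)
    (hne : ∃ y ∈ supp ρ, y ∉ B) : IsIsland G ρ k B where
  one_le := hk
  nonempty := hB
  subset := hBs
  dist_le := hBd
  exists_notMem := hne
  far x hx y hy hyB := by
    have h1 := hfar x hx y hy hyB
    have h2 : (2 : ℝ) ^ (k + 1) ≤ (2 : ℝ) ^ (α * ((k : ℝ) + 1)) := by
      rw [← Real.rpow_natCast]
      refine Real.rpow_le_rpow_of_exponent_le (by norm_num) ?_
      push_cast
      have : (0 : ℝ) ≤ k := by positivity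
      nlinarith
    have h3 : (16 * 2 ^ (k + 1) : ℝ) ≤ G.dist x y := by
      refine le_trans ?_ h1
      rw [M]
      have : (0 : ℝ) < 2 ^ (k + 1) := by positivity
      nlinarith
    exact_mod_cast h3
  charge := by
    classical
    -- Splitting `ρ` along `B` is a decomposition to which the ensemble property applies: the
    -- smaller diameter is at most that of `B`, hence at most `2^(k+1)`, and this is the scale in
    -- the separation of squares.
    set ρ₁ : V → ℤ := fun p => if p ∈ B then ρ p else 0 with hρ₁
    set ρ₂ : V → ℤ := fun p => if p ∈ B then 0 else ρ p with hρ₂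
    have s1 : ∀ p, p ∈ supp ρ₁ ↔ p ∈ B := by
      intro p
      rw [mem_supp]
      simp only [hρ₁, ne_eq, ite_eq_right_iff, not_forall]
      exact ⟨fun h => h.1, fun h => ⟨h, mem_supp.mp (hBs h)⟩⟩
    have s2 : ∀ p, p ∈ supp ρ₂ ↔ p ∉ B ∧ p ∈ supp ρ := by
      intro p
      rw [mem_supp, mem_supp]
      simp only [hρ₂]
      split_ifs with h <;> simp [h]
    obtain ⟨x, hx⟩ := hB
    obtain ⟨y, hy, hyB⟩ := hne
    have n1 : (supp ρ₁).Nonempty := ⟨x, (s1 x).mpr hx⟩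
    have n2 : (supp ρ₂).Nonempty := ⟨y, (s2 y).mpr ⟨hyB, hy⟩⟩
    have hd : diam G ρ₁ ≤ 2 ^ (k + 1) := by
      refine Finset.sup_le fun p hp => ?_
      rw [Finset.mem_product, s1, s1] at hp
      exact hBd _ hp.1 _ hp.2
    have key := hsep.decomposition ρ hρ hcharge ρ₁ ρ₂ ?_ ?_ ?_ ?_ ?_
    · have : charge ρ₁ = ∑ p ∈ B, ρ p := by
        simp [charge, hρ₁]
      exact this ▸ key.1
    · intro h; obtain ⟨p, hp⟩ := n1; exact mem_supp.mp hp (congrFun h p)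
    · intro h; obtain ⟨p, hp⟩ := n2; exact mem_supp.mp hp (congrFun h p)
    · rw [Finset.disjoint_left]
      intro p hp hp'
      exact ((s2 p).mp hp').1 ((s1 p).mp hp)
    · ext p
      simp only [hρ₁, hρ₂, Pi.add_apply]
      split_ifs <;> simp
    · obtain ⟨p, hp, q, hq, hpq⟩ := exists_dist_eq_setDist (G := G) n1 n2
      rw [chargeDist, ← hpq]
      refine le_trans ?_ (hfar p ((s1 p).mp hp) q ((s2 q).mp hq).2 ((s2 q).mp hq).1)
      have h1 : ((min (diam G ρ₁) (diam G ρ₂) : ℕ) : ℝ) ≤ 2 ^ (k + 1) := by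
        exact_mod_cast (min_le_left _ _).trans hd
      have h2 : ((min (diam G ρ₁) (diam G ρ₂) : ℕ) : ℝ) ^ α ≤ 2 ^ (α * ((k : ℝ) + 1)) := by
        refine (Real.rpow_le_rpow (by positivity) h1 (by linarith)).trans (le_of_eq ?_)
        rw [← Real.rpow_natCast, ← Real.rpow_mul (by norm_num), mul_comm]
        push_cast
        rfl
      have : (0 : ℝ) ≤ M := by rw [M]; positivity
      gcongr

end Obstacles

/-! ### From separated squares to islands. -/

section Squares

variable {bc : BoundaryCondition} {n : ℕ} {α : ℝ}
  {S : ℕ → (Fin (n + 1) × Fin (n + 1) → ℤ) → Finset (Finset (Fin (n + 1) × Fin (n + 1)))}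
  {N : Finset (Fin (n + 1) × Fin (n + 1) → ℤ)} {ρ : Fin (n + 1) × Fin (n + 1) → ℤ}

lemma mem_separatedSquares {V : Type*} [Fintype V] [DecidableEq V]
    {G : SimpleGraph V} {k : ℕ} {S : Finset (Finset V)}
    {s : Finset V} : s ∈ separatedSquares G α k S ↔ S.card ≠ 1 ∧ s ∈ S ∧
      ∀ s' ∈ S, s' ≠ s → 2 * M * (2 : ℝ) ^ (α * ((k : ℝ) + 1)) ≤ (setDist G s' s : ℝ) := by
  unfold separatedSquares
  split_ifs with h <;> simp [h]

lemma eq_of_mem_separatedSquares {V : Type*} [Fintype V] [DecidableEq V]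
    {G : SimpleGraph V} {k : ℕ} {S : Finset (Finset V)}
    {s s' : Finset V} (hs : s ∈ separatedSquares G α k S) (hs' : s' ∈ S) {x : V} (hx : x ∈ s)
    (hx' : x ∈ s') : s' = s := by
  by_contra hne
  have h1 := (mem_separatedSquares.mp hs).2.2 s' hs' hne
  have h2 := setDist_le (G := G) hx' hx
  rw [SimpleGraph.dist_self, Nat.le_zero] at h2
  rw [h2, M] at h1
  have : (0 : ℝ) < 2 * 2 ^ 16 * (2 : ℝ) ^ (α * ((k : ℝ) + 1)) := by positivity
  rw [Nat.cast_zero] at h1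
  linarith

/-- Otherwise erasing `s` would leave a smaller cover. -/
lemma exists_mem_supp_of_mem_cover {L : ℕ}
    {S : ℕ → (Fin L × Fin L → ℤ) → Finset (Finset (Fin L × Fin L))}
    (hS : IsMinimalCoverChoice bc L S) {ρ : Fin L × Fin L → ℤ} (h0 : ρ ≠ 0) {k : ℕ}
    {s : Finset (Fin L × Fin L)} (hs : s ∈ S k ρ) : ∃ x ∈ supp ρ, x ∈ s := by
  by_contra! h
  obtain ⟨⟨h1, h2⟩, h3⟩ := hS k ρ h0
  have h4 := h3 ((S k ρ).erase s) ⟨fun t ht => h1 t (Finset.mem_of_mem_erase ht), fun j hj => by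
    obtain ⟨t, ht, hjt⟩ := h2 j hj
    refine ⟨t, Finset.mem_erase.mpr ⟨?_, ht⟩, hjt⟩
    rintro rfl
    exact h j hj hjt⟩
  exact absurd (Finset.card_erase_lt_of_mem hs) (by omega)

lemma isIsland_of_mem_separatedSquares (hα : 3 / 2 < α) (hS : IsMinimalCoverChoice bc (n + 1) S)
    (hsep : IsSeparated (squareDomain bc (n + 1)) α N) (hρ : ρ ∈ N) (h0 : ρ ≠ 0)
    (hcharge : charge ρ = 0) {k : ℕ} (hk : 1 ≤ k) {s : Finset (Fin (n + 1) × Fin (n + 1))}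
    (hs : s ∈ separatedSquares (squareDomain bc (n + 1)) α k (S k ρ)) :
    IsIsland (squareDomain bc (n + 1)) ρ k (supp ρ ∩ s) := by
  obtain ⟨hcard, hsS, hfar⟩ := mem_separatedSquares.mp hs
  obtain ⟨⟨hsq, hcov⟩, -⟩ := hS k ρ h0
  refine hsep.isIsland hα hρ hcharge hk ?_ Finset.inter_subset_left ?_ ?_ ?_
  · obtain ⟨x, hx, hxs⟩ := exists_mem_supp_of_mem_cover hS h0 hsS
    exact ⟨x, Finset.mem_inter.mpr ⟨hx, hxs⟩⟩
  · intro x hx y hy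
    exact dist_le_of_isSquare (hsq s hsS) (Finset.mem_inter.mp hx).2 (Finset.mem_inter.mp hy).2
  · intro x hx y hy hyB
    obtain ⟨t, ht, hyt⟩ := hcov y hy
    have hts : t ≠ s := by
      rintro rfl
      exact hyB (Finset.mem_inter.mpr ⟨hy, hyt⟩)
    refine (hfar t ht hts).trans ?_
    rw [SimpleGraph.dist_comm]
    exact_mod_cast setDist_le hyt (Finset.mem_inter.mp hx).2
  · have : 1 < (S k ρ).card := by
      have := Finset.card_pos.mpr ⟨s, hsS⟩
      omega
    obtain ⟨t, ht, hts⟩ := Finset.exists_mem_ne this s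
    obtain ⟨y, hy, hyt⟩ := exists_mem_supp_of_mem_cover hS h0 ht
    refine ⟨y, hy, fun hyB => hts ?_⟩
    exact eq_of_mem_separatedSquares hs ht (Finset.mem_inter.mp hyB).2 hyt

lemma separatedSquares_eq_empty {L : ℕ} {G : SimpleGraph (Fin L × Fin L)}
    {S : ℕ → (Fin L × Fin L → ℤ) → Finset (Finset (Fin L × Fin L))}
    (hS : IsMinimalCoverChoice bc L S) {ρ : Fin L × Fin L → ℤ} (h0 : ρ ≠ 0) {k : ℕ}
    (hk : L < 2 ^ k) : separatedSquares G α k (S k ρ) = ∅ := by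
  obtain ⟨⟨hsq, hcov⟩, -⟩ := hS k ρ h0
  have huniv : ∀ s ∈ S k ρ, s = Finset.univ := fun s hs => by
    simpa [not_le.mpr hk] using (hsq s hs).2
  have hcard : (S k ρ).card = 1 := by
    obtain ⟨p, hp⟩ := Function.ne_iff.mp h0
    obtain ⟨s, hs, -⟩ := hcov p (mem_supp.mpr hp)
    rw [Finset.card_eq_one]
    refine ⟨Finset.univ, Finset.eq_singleton_iff_unique_mem.mpr ⟨huniv s hs ▸ hs, huniv⟩⟩
  simp [separatedSquares, hcard]

/-- The islands cut out by the separated squares of all scales below `K`. -/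
noncomputable def islands (bc : BoundaryCondition) (α : ℝ)
    (S : ℕ → (Fin (n + 1) × Fin (n + 1) → ℤ) → Finset (Finset (Fin (n + 1) × Fin (n + 1))))
    (ρ : Fin (n + 1) × Fin (n + 1) → ℤ) (K : ℕ) : Finset (ℕ × Finset (Fin (n + 1) × Fin (n + 1))) :=
  ((Finset.range K).sigma fun k =>
    separatedSquares (squareDomain bc (n + 1)) α (k + 1) (S (k + 1) ρ)).image
      fun i => (i.1 + 1, supp ρ ∩ i.2)

/-- Distinct separated squares of one scale are disjoint and each meets `supp ρ`, so they cut out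
distinct islands; the scale is recorded in the pair. -/
lemma card_islands (hS : IsMinimalCoverChoice bc (n + 1) S) (h0 : ρ ≠ 0) (K : ℕ) :
    (islands bc α S ρ K).card = ∑ k ∈ Finset.range K,
      (separatedSquares (squareDomain bc (n + 1)) α (k + 1) (S (k + 1) ρ)).card := by
  rw [islands, Finset.card_image_of_injOn, Finset.card_sigma]
  rintro ⟨k, s⟩ hs ⟨k', s'⟩ hs' h
  simp only [Finset.coe_sigma, Set.mem_sigma_iff, Finset.mem_coe] at hs hs'
  simp only [Prod.mk.injEq, add_left_inj] at h
  obtain ⟨rfl, h⟩ := h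
  obtain ⟨x, hx, hxs⟩ := exists_mem_supp_of_mem_cover hS h0 (mem_separatedSquares.mp hs.2).2.1
  have hx' : x ∈ supp ρ ∩ s' := h ▸ Finset.mem_inter.mpr ⟨hx, hxs⟩
  have := eq_of_mem_separatedSquares hs.2 (mem_separatedSquares.mp hs'.2).2.1 hxs
    (Finset.mem_inter.mp hx').2
  rw [this]

end Squares

end SpinWave

theorem proposition2p4 (α : ℝ) (hα₁ : 3 / 2 < α) (hα₂ : α < 2) :
    ∃ D₃ : ℝ, 0 < D₃ ∧
      ∀ (bc : SpinWave.BoundaryCondition) (L : ℕ), 1 < L →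
      (bc = SpinWave.BoundaryCondition.periodic → Even L) →
      ∀ (β : ℝ), 0 < β →
      ∀ (center : (Fin L × Fin L → ℤ) → Fin L × Fin L),
      SpinWave.IsCenterChoice (SpinWave.squareDomain bc L) center →
      ∀ (S : ℕ → (Fin L × Fin L → ℤ) → Finset (Finset (Fin L × Fin L))),
      SpinWave.IsMinimalCoverChoice bc L S →
      ∀ (N : Finset (Fin L × Fin L → ℤ)),
      SpinWave.IsEnsemble N →
      SpinWave.IsSeparated (SpinWave.squareDomain bc L) α N →
      ∀ ρ ∈ SpinWave.neutral N, ∃ a : Fin L × Fin L → ℝ,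
        (∀ ρ' ∈ SpinWave.smaller (SpinWave.squareDomain bc L) (SpinWave.neutral N) ρ,
          ∀ i ∈ SpinWave.DPlus (SpinWave.squareDomain bc L) center ρ',
          ∀ j ∈ SpinWave.DPlus (SpinWave.squareDomain bc L) center ρ', a i = a j) ∧
        Function.support a ⊆ SpinWave.D (SpinWave.squareDomain bc L) center ρ ∧
        (∀ ρ' ∈ SpinWave.neutral N, ρ' ≠ ρ →
          ρ' ∉ SpinWave.smaller (SpinWave.squareDomain bc L) (SpinWave.neutral N) ρ →
          Disjoint (Function.support a) (Function.support ρ')) ∧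
        Function.support (SpinWave.laplacian (SpinWave.squareDomain bc L) a) ⊆
          SpinWave.D (SpinWave.squareDomain bc L) center ρ ∧
        Summable (fun k : ℕ =>
          ((SpinWave.separatedSquares (SpinWave.squareDomain bc L) α (k + 1)
            (S (k + 1) ρ)).card : ℝ)) ∧
        1 / β * (1 / 16 * SpinWave.norm₂ ρ ^ 2 +
            D₃ * ∑' k : ℕ, ((SpinWave.separatedSquares (SpinWave.squareDomain bc L) α (k + 1)
              (S (k + 1) ρ)).card : ℝ)) ≤
          SpinWave.energy (SpinWave.squareDomain bc L) β a ρ := by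

  refine ⟨1 / 1764, by norm_num, ?_⟩
  intro bc L hL heven β hβ center hcenter S hS N hN hsep ρ hρ
  obtain ⟨n, rfl⟩ : ∃ n, L = n + 1 + 1 := ⟨L - 2, by omega⟩
  obtain ⟨hρN, hcharge⟩ := SpinWave.mem_neutral.mp hρ
  have h0 := hN.1 ρ hρN
  have hG : (SpinWave.squareDomain bc (n + 1 + 1)).Connected :=
    SpinWave.squareDomain_connected (n + 1)
  obtain ⟨f, hf⟩ := SpinWave.squareDomain_exists_coloring (n + 1 + 1) heven
  have hcρ := (hcenter ρ h0).1
  set G := SpinWave.squareDomain bc (n + 1 + 1) with hGdef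
  obtain ⟨a, ha1, ha2, ha3⟩ := SpinWave.exists_wave hG hf
    SpinWave.squareDomain_card_neighbors_le SpinWave.squareDomain_card_ball_le hβ h0 hcharge hcρ
    (R := SpinWave.SameObstacle G center (SpinWave.smaller G (SpinWave.neutral N) ρ))
    (fun p q ⟨ρ', h, hp, hq⟩ => ⟨ρ', h, hq, hp⟩)
    (fun p q ⟨ρ', h, hp, _⟩ => SpinWave.notMem_supp_of_mem_DPlus hG hα₁ hcenter hN hsep hρN h hp)
    (fun x hx => SpinWave.dist_le_of_chain_sameObstacle hG hα₁ hα₂ hcenter hN hsep hρN hx)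
    (SpinWave.islands bc α S ρ (n + 1 + 1)) (by
      intro i hi
      obtain ⟨⟨k, s⟩, hs, rfl⟩ := Finset.mem_image.mp hi
      exact SpinWave.isIsland_of_mem_separatedSquares hα₁ hS hsep hρN h0 hcharge (by simp)
        (Finset.mem_sigma.mp hs).2)
  have hzero : ∀ k ∉ Finset.range (n + 1 + 1),
      ((SpinWave.separatedSquares G α (k + 1) (S (k + 1) ρ)).card : ℝ) = 0 := by
    intro k hk
    rw [Finset.mem_range, not_lt] at hk
    rw [SpinWave.separatedSquares_eq_empty hS h0
      ((Nat.lt_two_pow_self (n := n + 1 + 1)).trans (Nat.pow_lt_pow_right (by norm_num)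
        (by omega)))]
    simp
  refine ⟨a, ?_, ?_, ?_, ?_, summable_of_hasFiniteSupport
    ((Finset.range (n + 1 + 1)).finite_toSet.subset fun k hk => ?_), ?_⟩
  · exact fun ρ' hρ' i hi j hj => ha1 i j ⟨ρ', hρ', hi, hj⟩
  · intro p hp
    have := ha2 p hp
    show G.dist p (center ρ) < 2 * SpinWave.diam G ρ
    omega
  -- A much larger density stays at distance at least `M * d(ρ)^α` from the centre of `ρ`, beyond
  -- the radius `2 * d(ρ)`.
  · intro ρ' hρ' hne hlarge
    rw [Set.disjoint_left]
    intro p hp hp'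
    obtain ⟨hρ'N, -⟩ := SpinWave.mem_neutral.mp hρ'
    have h1 : 2 * SpinWave.diam G ρ < SpinWave.diam G ρ' := by
      by_contra h
      exact hlarge (SpinWave.mem_smaller.mpr ⟨hρ', not_lt.mp h, hne.symm⟩)
    have h2 := hsep.le_dist hρ'N hρN hne (SpinWave.mem_supp.mpr hp') hcρ
    rw [min_eq_right (by omega)] at h2
    have h3 := SpinWave.natCast_le_rpow hα₁ (SpinWave.diam G ρ)
    have h4 : 65536 * (SpinWave.diam G ρ : ℝ) ≤ G.dist p (center ρ) := by linarith
    have h5 : 65536 * SpinWave.diam G ρ ≤ G.dist p (center ρ) := by exact_mod_cast h4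
    have h6 := ha2 p hp
    omega
  · intro p hp
    show G.dist p (center ρ) < 2 * SpinWave.diam G ρ
    by_cases hap : a p = 0
    -- A nonzero Laplacian where `a` vanishes requires a neighbour in the support of `a`; the margin
    -- of 2 pays for this extra step.
    · obtain ⟨q, -, hq⟩ := Finset.exists_ne_zero_of_sum_ne_zero hp
      simp only [ne_eq, ite_eq_right_iff, not_forall] at hq
      obtain ⟨e, hq⟩ := hq
      have h1 := ha2 q (by simpa [hap] using hq)
      have h2 := hG.dist_triangle (u := p) (v := q) (w := center ρ)
      rw [SimpleGraph.dist_eq_one_iff_adj.mpr e] at h2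
      omega
    · have := ha2 p hap
      omega
  · by_contra h
    exact hk (hzero k h)
  · rw [tsum_eq_sum hzero]
    rw [SpinWave.card_islands hS h0] at ha3
    push_cast at ha3
    exact ha3
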